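/- Let $k$ be a field, $n\ge 2$ an integer and $q\in k$ a primitive $n$-th root of unity. **The Taft category.** Let $C_n=\langle t\mid t^n=1\rangle$. The $k$-category $\mathcal T_{n,q}$ is the quotient of the free $k$-category with set of objects $C_n$ and one generating morphism $a_u:u\to tu$ for each $u\in C_n$ by the two-sided ideal generated by all paths of length $n$. It is a Hopf $k$-category over $C_n$ with the comultiplication induced by $\Delta(a_{t^i})=\sum_{t^jt^l=t^i}\left(\mathrm{id}_{t^j}\otimes a_{t^l}+q^l\,a_{t^j}\otimes \mathrm{id}_{t^l}\right)$ (with the unique counit and antipode; the counit vanishes on morphisms between objects that are not both equal to $1$). **Gradings.** A grading $X$ of a $k$-category $\mathcal B$ by a group $\Gamma_X$ is a decomposition ${}_y\mathcal B_x=\bigoplus_{s\in\Gamma_X}X^s{}_y\mathcal B_x$ of every space of morphisms with $X^t\,X^s\subset X^{ts}$. A homogeneous walk is a composable sequence $(f_m,\epsilon_m)\cdots(f_1,\epsilon_1)$ of nonzero homogeneous morphisms $f_i$ with $\epsilon_i=\pm1$ (the sign $-1$ exchanges source and target), and its degree is $(\deg f_m)^{\epsilon_m}\cdots(\deg f_1)^{\epsilon_1}$.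 The grading is connected if for all objects $x,y$ every element of $\Gamma_X$ is the degree of a homogeneous walk from $x$ to $y$. A morphism $X\to Y$ of connected gradings, with base object $b$, is a group morphism $\mu:\Gamma_X\to\Gamma_Y$ for which there is an invertible $k$-linear endofunctor $J$ of $\mathcal B$, the identity on objects and sending homogeneous morphisms to homogeneous morphisms, such that $\mu(\deg_X w)=\deg_Y J(w)$ for every homogeneous walk $w$ from $b$ to $b$. The group $\Pi_1(\mathcal B,b)$ consists of the families $(\gamma_X)_X$, $\gamma_X\in\Gamma_X$, indexed by the connected gradings, with $\mu(\gamma_X)=\gamma_Y$ for every morphism $\mu:X\to Y$, with the pointwise product. **Hopf gradings.** A Hopf grading of a Hopf $k$-category over a finite group is a grading by an abelian group for which the comultiplication, the counit and the antipode are homogeneous; morphisms of connected Hopf gradings are defined as above with $b=1$ and $J$ an endofunctor of Hopf $k$-categories. $\Pi_1^{\mathsf H}$ is the group of compatible families indexed by the connected Hopf gradings with finite grading group, and $\tau:\Pi_1(\mathcal T_{n,q},1)\to\Pi_1^{\mathsf H}(\mathcal T_{n,q})$ is the homomorphism that restricts a family to the connected Hopf gradings. **Proposition.** For each connected grading $X$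 of $\mathcal T_{n,q}$ let $c_X=(\deg_X a_{t^{n-1}})\cdots(\deg_X a_t)(\deg_X a_1)\in\Gamma_X$. There is a commutative diagram of groups $$\begin{array}{ccc}\Pi_1(\mathcal T_{n,q},1)&\xrightarrow{\ \tau\ }&\Pi_1^{\mathsf H}(\mathcal T_{n,q})\\ {\scriptstyle L}\downarrow&&\downarrow{\scriptstyle R}\\ \mathbb Z&\longrightarrow&\varprojlim_{(m,n)=1}\mathbb Z/m\mathbb Z\end{array}$$ in which the limit is over the positive integers $m$ coprime to $n$, with the canonical projections $\mathbb Z/m\mathbb Z\to\mathbb Z/m'\mathbb Z$ for $m'\mid m$, the bottom arrow is induced by the canonical projections $\mathbb Z\to\mathbb Z/m\mathbb Z$, $L$ is the isomorphism characterised by $\gamma_X=c_X^{L(\gamma)}$ for every connected grading $X$, and $R$ is the isomorphism characterised by $\delta_X=c_X^{R(\delta)_m}$, $m=|\Gamma_X|$, for every connected Hopf grading $X$ with finite grading group (whose order is then coprime to $n$). The bottom arrow is injective, and hence $\tau$ is injective. -/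

import Mathlib

open CategoryTheory TensorProduct

universe u v w o

noncomputable section

namespace HopfCat

/-! ### Linear categories: two-sided ideals, quotients, free linear categories

A `k`-category is a category with Mathlib's `Preadditive` and `Linear k` structures.
The space written `_yB_x` in the literature is `x ⟶ y`, and `g f` is `f ≫ g`. -/

section Ideals

variable (k : Type u) [Field k] (B : Type o) [Category.{v} B] [Preadditive B] [Linear k B]

/-- A two-sided ideal of a `k`-category: a family of subspaces of the spaces of morphisms which is
stable under composition with arbitrary morphisms on both sides. -/
structure LinIdeal where
  hom : ∀ x y : B, Submodule k (x ⟶ y)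
  comp_mem_left : ∀ {x y z : B} (f : x ⟶ y) (g : y ⟶ z), g ∈ hom y z → f ≫ g ∈ hom x z
  comp_mem_right : ∀ {x y z : B} (f : x ⟶ y) (g : y ⟶ z), f ∈ hom x y → f ≫ g ∈ hom x z

variable {k B}

/-- The smallest two-sided ideal containing a given family of sets of morphisms. -/
def LinIdeal.span (S : ∀ x y : B, Set (x ⟶ y)) : LinIdeal k B where
  hom x y := ⨅ (I : LinIdeal k B) (_ : ∀ x y, S x y ⊆ I.hom x y), I.hom x y
  comp_mem_left f g hg := by
    simp only [Submodule.mem_iInf] at hg ⊢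
    exact fun I hI => I.comp_mem_left f g (hg I hI)
  comp_mem_right f g hf := by
    simp only [Submodule.mem_iInf] at hf ⊢
    exact fun I hI => I.comp_mem_right f g (hf I hI)

theorem LinIdeal.span_le (S : ∀ x y : B, Set (x ⟶ y)) (I : LinIdeal k B)
    (hI : ∀ x y, S x y ⊆ I.hom x y) (x y : B) : (LinIdeal.span S).hom x y ≤ I.hom x y :=
  iInf₂_le I hI

theorem LinIdeal.subset_span (S : ∀ x y : B, Set (x ⟶ y)) (x y : B) :
    S x y ⊆ (LinIdeal.span (k := k) S).hom x y := by
  intro f hf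
  simp only [LinIdeal.span, SetLike.mem_coe, Submodule.mem_iInf]
  exact fun I hI => hI x y hf

/-- The quotient `k`-category `B / I`: same objects, quotient spaces of morphisms. -/
def LinIdeal.Quot (_ : LinIdeal k B) : Type o := B

namespace LinIdeal

variable (I : LinIdeal k B)

variable {I} in
/-- The object of `B` underlying an object of `B / I`. -/
def Quot.un (x : I.Quot) : B := x

/-- An object of `B`, as an object of `B / I`. -/
def obj (x : B) : I.Quot := x

/-- Composition on the quotient spaces. -/
def quotComp (x y z : B) :
    ((x ⟶ y) ⧸ I.hom x y) →ₗ[k] ((y ⟶ z) ⧸ I.hom y z) →ₗ[k] ((x ⟶ z) ⧸ I.hom x z) :=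
  Submodule.liftQ _
    { toFun := fun f => Submodule.liftQ _ ((I.hom x z).mkQ ∘ₗ Linear.leftComp k z f) (by
        intro g hg
        simpa using I.comp_mem_left f g hg)
      map_add' := by
        intro f f'
        refine Submodule.linearMap_qext _ (LinearMap.ext fun g => ?_)
        simp
      map_smul' := by
        intro c f
        refine Submodule.linearMap_qext _ (LinearMap.ext fun g => ?_)
        simp }
    (by
      intro f hf
      refine Submodule.linearMap_qext _ (LinearMap.ext fun g => ?_)
      simpa using I.comp_mem_right f g hf)

@[simp] theorem quotComp_mk {x y z : B} (f : x ⟶ y) (g : y ⟶ z) :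
    I.quotComp x y z (Submodule.Quotient.mk f) (Submodule.Quotient.mk g)
      = Submodule.Quotient.mk (f ≫ g) := rfl

instance : Category.{v} I.Quot where
  Hom x y := (x.un ⟶ y.un) ⧸ I.hom x.un y.un
  id x := Submodule.Quotient.mk (𝟙 x.un)
  comp {x y z} f g := I.quotComp x.un y.un z.un f g
  id_comp {x y} f := by
    obtain ⟨f, rfl⟩ := Submodule.Quotient.mk_surjective (I.hom x.un y.un) f
    exact congrArg (Submodule.Quotient.mk (p := I.hom x.un y.un)) (Category.id_comp f)
  comp_id {x y} f := by
    obtain ⟨f, rfl⟩ := Submodule.Quotient.mk_surjective (I.hom x.un y.un) f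
    exact congrArg (Submodule.Quotient.mk (p := I.hom x.un y.un)) (Category.comp_id f)
  assoc {x y z t} f g h := by
    obtain ⟨f, rfl⟩ := Submodule.Quotient.mk_surjective (I.hom x.un y.un) f
    obtain ⟨g, rfl⟩ := Submodule.Quotient.mk_surjective (I.hom y.un z.un) g
    obtain ⟨h, rfl⟩ := Submodule.Quotient.mk_surjective (I.hom z.un t.un) h
    exact congrArg (Submodule.Quotient.mk (p := I.hom x.un t.un)) (Category.assoc f g h)

instance : Preadditive I.Quot where
  homGroup x y := inferInstanceAs (AddCommGroup ((x.un ⟶ y.un) ⧸ I.hom x.un y.un))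
  add_comp x y z f f' g := LinearMap.congr_fun (LinearMap.map_add (I.quotComp x.un y.un z.un) f f') g
  comp_add x y z f g g' := LinearMap.map_add (I.quotComp x.un y.un z.un f) g g'

instance : Linear k I.Quot where
  homModule x y := inferInstanceAs (Module k ((x.un ⟶ y.un) ⧸ I.hom x.un y.un))
  smul_comp x y z c f g := LinearMap.congr_fun (LinearMap.map_smul (I.quotComp x.un y.un z.un) c f) g
  comp_smul x y z f c g := LinearMap.map_smul (I.quotComp x.un y.un z.un f) c g

/-- The class of a morphism in the quotient category. -/
def cls {x y : B} : (x ⟶ y) →ₗ[k] (I.obj x ⟶ I.obj y) :=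
  (I.hom x y).mkQ

theorem cls_surjective {x y : B} : Function.Surjective (I.cls (x := x) (y := y)) :=
  Submodule.mkQ_surjective _

theorem cls_comp {x y z : B} (f : x ⟶ y) (g : y ⟶ z) :
    I.cls (f ≫ g) = I.cls f ≫ I.cls g := rfl

theorem cls_id (x : B) : I.cls (𝟙 x) = 𝟙 (I.obj x) := rfl

theorem cls_eq_zero {x y : B} (f : x ⟶ y) : I.cls f = 0 ↔ f ∈ I.hom x y :=
  Submodule.Quotient.mk_eq_zero _

/-- Linear maps out of a space of morphisms of the quotient category. -/
def lift {M : Type*} [AddCommGroup M] [Module k M] {x y : B} (φ : (x ⟶ y) →ₗ[k] M)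
    (hφ : I.hom x y ≤ LinearMap.ker φ) : (I.obj x ⟶ I.obj y) →ₗ[k] M :=
  (I.hom x y).liftQ φ hφ

theorem lift_cls {M : Type*} [AddCommGroup M] [Module k M] {x y : B} (φ : (x ⟶ y) →ₗ[k] M)
    (hφ : I.hom x y ≤ LinearMap.ker φ) (f : x ⟶ y) : I.lift φ hφ (I.cls f) = φ f := rfl

end LinIdeal

end Ideals

section FreeCategory

variable (k : Type u) [Field k] {V : Type o} [Quiver.{v} V]

variable (V) in
/-- The free `k`-category on a quiver: the linearisation of its category of paths. -/
abbrev FreeCat : Type o := Free k (Paths V)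

/-- A vertex of the quiver, as an object of the free `k`-category. -/
def freeObj (x : V) : FreeCat k V := Free.of k ((Paths.of V).obj x)

/-- A path, as a morphism of the free `k`-category. -/
def freePath {x y : V} (p : Quiver.Path x y) : freeObj k x ⟶ freeObj k y :=
  (Free.embedding k (Paths V)).map (X := (Paths.of V).obj x) (Y := (Paths.of V).obj y) p

theorem freePath_comp {x y z : V} (p : Quiver.Path x y) (p' : Quiver.Path y z) :
    freePath k (p.comp p') = freePath k p ≫ freePath k p' :=
  (Free.embedding k (Paths V)).map_comp (X := (Paths.of V).obj x) (Y := (Paths.of V).obj y)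
    (Z := (Paths.of V).obj z) p p'

theorem freePath_nil (x : V) :
    freePath k (Quiver.Path.nil : Quiver.Path x x) = 𝟙 (freeObj k x) :=
  (Free.embedding k (Paths V)).map_id ((Paths.of V).obj x)

variable {k}

/-- The linear map out of a space of morphisms of the free `k`-category with given values on
paths. -/
def freeLift {M : Type*} [AddCommGroup M] [Module k M] {x y : V} (φ : Quiver.Path x y → M) :
    (freeObj k x ⟶ freeObj k y) →ₗ[k] M :=
  (Finsupp.linearCombination k φ : (Quiver.Path x y →₀ k) →ₗ[k] M)

theorem freeLift_path {M : Type*} [AddCommGroup M] [Module k M] {x y : V}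
    (φ : Quiver.Path x y → M) (p : Quiver.Path x y) : freeLift φ (freePath k p) = φ p := by
  have := Finsupp.linearCombination_single k (1 : k) p (v := φ)
  rw [one_smul] at this
  exact this

theorem free_ext {M : Type*} [AddCommGroup M] [Module k M] {x y : V}
    {φ ψ : (freeObj k x ⟶ freeObj k y) →ₗ[k] M}
    (h : ∀ p : Quiver.Path x y, φ (freePath k p) = ψ (freePath k p)) : φ = ψ := by
  have : ∀ φ ψ : (Quiver.Path x y →₀ k) →ₗ[k] M,
      (∀ p, φ (Finsupp.single p 1) = ψ (Finsupp.single p 1)) → φ = ψ := by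
    intro φ ψ h
    refine Finsupp.lhom_ext' fun p => LinearMap.ext_ring (h p)
  exact this φ ψ h

end FreeCategory

/-! ### Hopf `k`-categories over a finite group -/

section Hopf

variable (k : Type u) [Field k] (G : Type o) [Group G] [Fintype G]
  [Category.{v} G] [Preadditive G] [Linear k G]

variable {G} in
/-- `f'' ⊗ f' ↦ S(f'') f'`, for a given family of linear maps `S`. -/
def antipodeMulLeft (S : ∀ {x y : G}, (x ⟶ y) →ₗ[k] (y⁻¹ ⟶ x⁻¹)) (x₂ x₁ y₂ : G) :
    ((x₂ ⟶ y₂) ⊗[k] (x₁ ⟶ y₂⁻¹)) →ₗ[k] (x₁ ⟶ x₂⁻¹) :=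
  TensorProduct.lift ((Linear.comp x₁ y₂⁻¹ x₂⁻¹).flip ∘ₗ S)

variable {G} in
/-- `f'' ⊗ f' ↦ f'' S(f')`, for a given family of linear maps `S`. -/
def antipodeMulRight (S : ∀ {x y : G}, (x ⟶ y) →ₗ[k] (y⁻¹ ⟶ x⁻¹)) (x₁ y₂ y₁ : G) :
    ((x₁⁻¹ ⟶ y₂) ⊗[k] (x₁ ⟶ y₁)) →ₗ[k] (y₁⁻¹ ⟶ y₂) :=
  TensorProduct.lift ((Linear.comp y₁⁻¹ x₁⁻¹ y₂).flip.compl₂ S)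

/-- A Hopf `k`-category structure on a `k`-category whose set of objects is a finite group `G`.

The comultiplication
`_yΔ_x : Hom(x, y) → ⨁_{x₂ x₁ = x, y₂ y₁ = y} Hom(x₂, y₂) ⊗ Hom(x₁, y₁)`
is given by its components (the sum is finite), and each axiom is stated component by component.
For the antipode axioms: `Σ S(f'') f'` lies in the direct sum of all the spaces of morphisms
(compositions of non composable morphisms are zero) and `ε(f)` stands for `ε(f)` times its unit
`Σ_z id_z`. For `f : x → y` with `y ≠ 1`, respectively `x ≠ 1`, no pair of components is composable
in the first, respectively the second sum, and `ε(f) = 0`, so these cases carry no condition. -/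
structure HopfStructure where
  /-- The comultiplication. -/
  comul : ∀ {x y : G} (x₂ x₁ y₂ y₁ : G), x₂ * x₁ = x → y₂ * y₁ = y →
    ((x ⟶ y) →ₗ[k] (x₂ ⟶ y₂) ⊗[k] (x₁ ⟶ y₁))
  /-- `Δ(g f) = Δ(g) Δ(f)`. -/
  comul_comp : ∀ {x y z : G} (f : x ⟶ y) (g : y ⟶ z) (x₂ x₁ z₂ z₁ : G) (hx : x₂ * x₁ = x)
    (hz : z₂ * z₁ = z), comul x₂ x₁ z₂ z₁ hx hz (f ≫ g) =
      ∑ y₂ : G, TensorProduct.map₂ (Linear.comp (S := k) x₂ y₂ z₂)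
        (Linear.comp (S := k) x₁ (y₂⁻¹ * y) z₁)
        (comul x₂ x₁ y₂ (y₂⁻¹ * y) hx (mul_inv_cancel_left y₂ y) f)
        (comul y₂ (y₂⁻¹ * y) z₂ z₁ (mul_inv_cancel_left y₂ y) hz g)
  /-- `Δ(id_x) = Σ_{x₂ x₁ = x} id_{x₂} ⊗ id_{x₁}`. -/
  comul_id : ∀ {x : G} (x₂ x₁ : G) (hx : x₂ * x₁ = x),
    comul x₂ x₁ x₂ x₁ hx hx (𝟙 x) = 𝟙 x₂ ⊗ₜ[k] 𝟙 x₁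
  comul_id_of_ne : ∀ {x : G} (x₂ x₁ y₂ y₁ : G) (hx : x₂ * x₁ = x) (hy : y₂ * y₁ = x),
    x₂ ≠ y₂ → comul x₂ x₁ y₂ y₁ hx hy (𝟙 x) = 0
  /-- The counit. -/
  counit : ∀ {x y : G}, (x ⟶ y) →ₗ[k] k
  counit_comp : ∀ {x y z : G} (f : x ⟶ y) (g : y ⟶ z), counit (f ≫ g) = counit g * counit f
  counit_id : counit (𝟙 (1 : G)) = 1
  counit_eq_zero : ∀ {x y : G} (f : x ⟶ y), x ≠ 1 ∨ y ≠ 1 → counit f = 0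
  /-- The antipode, a contravariant functor. -/
  antipode : ∀ {x y : G}, (x ⟶ y) →ₗ[k] (y⁻¹ ⟶ x⁻¹)
  antipode_comp : ∀ {x y z : G} (f : x ⟶ y) (g : y ⟶ z),
    antipode (f ≫ g) = antipode g ≫ antipode f
  antipode_id : ∀ x : G, antipode (𝟙 x) = 𝟙 x⁻¹
  coassoc : ∀ {x y : G} (f : x ⟶ y) (x₃ x₂ x₁ y₃ y₂ y₁ : G) (hx : x₃ * x₂ * x₁ = x)
    (hy : y₃ * y₂ * y₁ = y),
    TensorProduct.assoc k (x₃ ⟶ y₃) (x₂ ⟶ y₂) (x₁ ⟶ y₁)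
      (TensorProduct.map (comul x₃ x₂ y₃ y₂ rfl rfl) LinearMap.id
        (comul (x₃ * x₂) x₁ (y₃ * y₂) y₁ hx hy f)) =
    TensorProduct.map LinearMap.id (comul x₂ x₁ y₂ y₁ rfl rfl)
      (comul x₃ (x₂ * x₁) y₃ (y₂ * y₁) ((mul_assoc _ _ _).symm.trans hx)
        ((mul_assoc _ _ _).symm.trans hy) f)
  /-- `ε(f'') f' = f`. -/
  counit_left : ∀ {x y : G} (f : x ⟶ y),
    TensorProduct.lid k (x ⟶ y) (TensorProduct.map counit LinearMap.id
      (comul 1 x 1 y (one_mul x) (one_mul y) f)) = f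
  /-- `f'' ε(f') = f`. -/
  counit_right : ∀ {x y : G} (f : x ⟶ y),
    TensorProduct.rid k (x ⟶ y) (TensorProduct.map LinearMap.id counit
      (comul x 1 y 1 (mul_one x) (mul_one y) f)) = f
  /-- `Σ S(f'') f' = ε(f)`: the components between equal and between different objects. -/
  antipode_left : ∀ {x : G} (f : x ⟶ 1) (x₂ x₁ : G) (hx : x₂ * x₁ = x) (h : x₁ = x₂⁻¹),
    ∑ y₂ : G, antipodeMulLeft k antipode x₂ x₁ y₂
      (comul x₂ x₁ y₂ y₂⁻¹ hx (mul_inv_cancel y₂) f) = counit f • eqToHom h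
  antipode_left_of_ne : ∀ {x : G} (f : x ⟶ 1) (x₂ x₁ : G) (hx : x₂ * x₁ = x), x₁ ≠ x₂⁻¹ →
    ∑ y₂ : G, antipodeMulLeft k antipode x₂ x₁ y₂
      (comul x₂ x₁ y₂ y₂⁻¹ hx (mul_inv_cancel y₂) f) = 0
  /-- `Σ f'' S(f') = ε(f)`: the components between equal and between different objects. -/
  antipode_right : ∀ {y : G} (f : 1 ⟶ y) (y₂ y₁ : G) (hy : y₂ * y₁ = y) (h : y₁⁻¹ = y₂),
    ∑ x₁ : G, antipodeMulRight k antipode x₁ y₂ y₁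
      (comul x₁⁻¹ x₁ y₂ y₁ (inv_mul_cancel x₁) hy f) = counit f • eqToHom h
  antipode_right_of_ne : ∀ {y : G} (f : 1 ⟶ y) (y₂ y₁ : G) (hy : y₂ * y₁ = y), y₁⁻¹ ≠ y₂ →
    ∑ x₁ : G, antipodeMulRight k antipode x₁ y₂ y₁
      (comul x₁⁻¹ x₁ y₂ y₁ (inv_mul_cancel x₁) hy f) = 0

end Hopf

/-! ### Gradings and the fundamental group of a linear category -/

section Gradings

variable (k : Type u) [Field k] (B : Type o) [Category.{v} B] [Preadditive B] [Linear k B]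

open scoped Classical in
/-- A grading of the `k`-category `B` by a group `Γ`. -/
structure Grading where
  Γ : Type w
  [group : Group Γ]
  /-- `comp s x y` is the homogeneous component of degree `s` from `x` to `y`. -/
  comp : Γ → ∀ x y : B, Submodule k (x ⟶ y)
  isInternal : ∀ x y : B, DirectSum.IsInternal fun s => comp s x y
  comp_mem : ∀ {x y z : B} (s t : Γ) (f : x ⟶ y) (g : y ⟶ z),
    f ∈ comp s x y → g ∈ comp t y z → f ≫ g ∈ comp (t * s) x z

attribute [instance] Grading.group

variable {k B}

namespace Grading

/-- `X`-homogeneous morphisms. -/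
def IsHomogeneous (X : Grading.{u, v, w, o} k B) {x y : B} (f : x ⟶ y) : Prop :=
  ∃ s, f ∈ X.comp s x y

/-- An `X`-homogeneous non zero virtual morphism `(f, 1)` or `(f, -1)`, from `x` to `y`. -/
inductive Step (X : Grading.{u, v, w, o} k B) : B → B → Type max o v
  | fwd {x y : B} (f : x ⟶ y) (hf : f ≠ 0) (h : X.IsHomogeneous f) : Step X x y
  | bwd {x y : B} (f : y ⟶ x) (hf : f ≠ 0) (h : X.IsHomogeneous f) : Step X x y

/-- `X`-homogeneous walks from `x` to `y`. -/
inductive Walk (X : Grading.{u, v, w, o} k B) : B → B → Type max o v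
  | single {x y : B} (a : X.Step x y) : Walk X x y
  | cons {x y z : B} (p : Walk X x y) (a : X.Step y z) : Walk X x z

variable {X Y : Grading.{u, v, w, o} k B}

/-- The degree of a virtual morphism. -/
def Step.deg {x y : B} : X.Step x y → X.Γ
  | .fwd _ _ h => h.choose
  | .bwd _ _ h => h.choose⁻¹

/-- The degree of a homogeneous walk: the product of the degrees, the last one on the left. -/
def Walk.deg {x y : B} : X.Walk x y → X.Γ
  | .single a => a.deg
  | .cons p a => a.deg * p.deg

variable (X) in
/-- A grading is connected if for any two objects every element of the grading group is the degree
of a homogeneous walk between them. -/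
def IsConnected : Prop :=
  ∀ x y : B, Function.Surjective fun p : X.Walk x y => p.deg

end Grading

variable (k B) in
/-- An invertible `k`-linear endofunctor of `B` which is the identity on objects. -/
structure LinAut where
  map : ∀ x y : B, (x ⟶ y) ≃ₗ[k] (x ⟶ y)
  map_id : ∀ x : B, map x x (𝟙 x) = 𝟙 x
  map_comp : ∀ {x y z : B} (f : x ⟶ y) (g : y ⟶ z), map x z (f ≫ g) = map x y f ≫ map y z g

namespace LinAut

/-- `J` is homogeneous with respect to gradings `X` and `Y` if it sends `X`-homogeneous morphisms
to `Y`-homogeneous ones. -/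
def IsHomogeneous (J : LinAut k B) (X Y : Grading.{u, v, w, o} k B) : Prop :=
  ∀ {x y : B} (f : x ⟶ y), X.IsHomogeneous f → Y.IsHomogeneous (J.map x y f)

variable {X Y : Grading.{u, v, w, o} k B} (J : LinAut k B) (hJ : J.IsHomogeneous X Y)

/-- The image of a homogeneous virtual morphism. -/
def mapStep {x y : B} : X.Step x y → Y.Step x y
  | .fwd f hf h => .fwd (J.map _ _ f) ((LinearEquiv.map_ne_zero_iff _).2 hf) (hJ f h)
  | .bwd f hf h => .bwd (J.map _ _ f) ((LinearEquiv.map_ne_zero_iff _).2 hf) (hJ f h)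

/-- The image `HW(J)(p)` of a homogeneous walk. -/
def mapWalk {x y : B} : X.Walk x y → Y.Walk x y
  | .single a => .single (J.mapStep hJ a)
  | .cons p a => .cons (mapWalk p) (J.mapStep hJ a)

/-- `μ` makes the square `μ ∘ deg_X = deg_Y ∘ HW(J)` on the walks from `b` to `b` commute. -/
def Realizes (b : B) (μ : X.Γ →* Y.Γ) : Prop :=
  ∃ hJ : J.IsHomogeneous X Y, ∀ p : X.Walk b b, μ p.deg = (J.mapWalk hJ p).deg

end LinAut

variable (k B) in
/-- Connected gradings. -/
structure ConnectedGrading extends Grading.{u, v, w, o} k B where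
  isConnected : toGrading.IsConnected

/-- Morphisms of connected gradings (with respect to a base object `b`). -/
def ConnectedGrading.IsMorphism (b : B) (X Y : ConnectedGrading.{u, v, w, o} k B)
    (μ : X.Γ →* Y.Γ) : Prop :=
  ∃ J : LinAut k B, J.Realizes (X := X.toGrading) (Y := Y.toGrading) b μ

variable (k) in
/-- The fundamental group `Π₁(B, b)`: families of elements of the groups of all connected gradings
which are compatible with all morphisms, with the pointwise product. -/
def Pi1 (b : B) : Subgroup (∀ X : ConnectedGrading.{u, v, w, o} k B, X.Γ) where
  carrier := {γ | ∀ (X Y : ConnectedGrading.{u, v, w, o} k B) (μ : X.Γ →* Y.Γ),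
    ConnectedGrading.IsMorphism b X Y μ → μ (γ X) = γ Y}
  mul_mem' {γ δ} hγ hδ X Y μ h := by
    rw [Pi.mul_apply, Pi.mul_apply, map_mul, hγ X Y μ h, hδ X Y μ h]
  one_mem' X Y μ _ := map_one μ
  inv_mem' {γ} hγ X Y μ h := by
    rw [Pi.inv_apply, Pi.inv_apply, map_inv, hγ X Y μ h]

end Gradings

/-! ### Hopf gradings, the fundamental group of a Hopf linear category, and the morphism `τ` -/

section HopfGradings

variable {k : Type u} [Field k] {G : Type o} [Group G] [Fintype G]
  [Category.{v} G] [Preadditive G] [Linear k G] (H : HopfStructure k G)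

/-- The comultiplication, the counit and the antipode are homogeneous. The component of degree `s`
of a tensor product is `Σ_{a b = s} X^a ⊗ X^b`, and `k` is of trivial degree. -/
structure Grading.IsHopf (X : Grading.{u, v, w, o} k G) : Prop where
  comm : ∀ s t : X.Γ, s * t = t * s
  comul : ∀ (s : X.Γ) {x y : G} (f : x ⟶ y), f ∈ X.comp s x y →
    ∀ (x₂ x₁ y₂ y₁ : G) (hx : x₂ * x₁ = x) (hy : y₂ * y₁ = y),
      H.comul x₂ x₁ y₂ y₁ hx hy f ∈ ⨆ (a : X.Γ) (b : X.Γ) (_ : a * b = s),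
        LinearMap.range (TensorProduct.map (X.comp a x₂ y₂).subtype (X.comp b x₁ y₁).subtype)
  counit : ∀ (s : X.Γ) {x y : G} (f : x ⟶ y), f ∈ X.comp s x y → s ≠ 1 → H.counit f = 0
  antipode : ∀ (s : X.Γ) {x y : G} (f : x ⟶ y), f ∈ X.comp s x y →
    H.antipode f ∈ X.comp s y⁻¹ x⁻¹

/-- Connected Hopf gradings with finite (abelian) grading group. -/
structure ConnectedHopfGrading extends ConnectedGrading.{u, v, w, o} k G where
  isHopf : toGrading.IsHopf H
  finite : Finite Γ

/-- `J` is an endofunctor of Hopf `k`-categories. -/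
structure LinAut.IsHopf (J : LinAut k G) : Prop where
  comul : ∀ {x y : G} (f : x ⟶ y) (x₂ x₁ y₂ y₁ : G) (hx : x₂ * x₁ = x) (hy : y₂ * y₁ = y),
    H.comul x₂ x₁ y₂ y₁ hx hy (J.map x y f) =
      TensorProduct.map (J.map x₂ y₂).toLinearMap (J.map x₁ y₁).toLinearMap
        (H.comul x₂ x₁ y₂ y₁ hx hy f)
  counit : ∀ {x y : G} (f : x ⟶ y), H.counit (J.map x y f) = H.counit f
  antipode : ∀ {x y : G} (f : x ⟶ y), H.antipode (J.map x y f) = J.map y⁻¹ x⁻¹ (H.antipode f)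

variable {H} in
/-- Morphisms of connected Hopf gradings. -/
def ConnectedHopfGrading.IsMorphism (X Y : ConnectedHopfGrading.{u, v, w, o} H)
    (μ : X.Γ →* Y.Γ) : Prop :=
  ∃ J : LinAut k G, J.IsHopf H ∧ J.Realizes (X := X.toGrading) (Y := Y.toGrading) 1 μ

/-- The fundamental group `Π₁ᴴ` of a Hopf `k`-category. -/
def Pi1Hopf : Subgroup (∀ X : ConnectedHopfGrading.{u, v, w, o} H, X.Γ) where
  carrier := {γ | ∀ (X Y : ConnectedHopfGrading.{u, v, w, o} H) (μ : X.Γ →* Y.Γ),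
    X.IsMorphism Y μ → μ (γ X) = γ Y}
  mul_mem' {γ δ} hγ hδ X Y μ h := by
    rw [Pi.mul_apply, Pi.mul_apply, map_mul, hγ X Y μ h, hδ X Y μ h]
  one_mem' X Y μ _ := map_one μ
  inv_mem' {γ} hγ X Y μ h := by
    rw [Pi.inv_apply, Pi.inv_apply, map_inv, hγ X Y μ h]

/-- The morphism `τ : Π₁(H, 1) → Π₁ᴴ(H)`: restriction of a family to the connected Hopf gradings. -/
def tau : Pi1.{u, v, w, o} k (1 : G) →* Pi1Hopf.{u, v, w, o} H where
  toFun γ := ⟨fun X => γ.1 X.toConnectedGrading, fun X Y μ h =>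
    γ.2 X.toConnectedGrading Y.toConnectedGrading μ (let ⟨J, _, hJ⟩ := h; ⟨J, hJ⟩)⟩
  map_one' := rfl
  map_mul' _ _ := rfl

end HopfGradings

/-! ### Gaussian binomial coefficients -/

section Gauss

variable {k : Type u} [Field k]

/-- The Gaussian binomial coefficient `[m choose r]_q`. -/
def qChoose (q : k) : ℕ → ℕ → k
  | _, 0 => 1
  | 0, _ + 1 => 0
  | m + 1, r + 1 => qChoose q m (r + 1) + q ^ (m - r) * qChoose q m r

variable (q : k)

@[simp] theorem qChoose_zero_right (m : ℕ) : qChoose q m 0 = 1 := by cases m <;> rfl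

@[simp] theorem qChoose_zero_succ (r : ℕ) : qChoose q 0 (r + 1) = 0 := rfl

theorem qChoose_succ_succ (m r : ℕ) :
    qChoose q (m + 1) (r + 1) = qChoose q m (r + 1) + q ^ (m - r) * qChoose q m r := rfl

theorem qChoose_eq_zero {m r : ℕ} (h : m < r) : qChoose q m r = 0 := by
  induction m generalizing r with
  | zero => obtain ⟨r, rfl⟩ := Nat.exists_eq_succ_of_ne_zero h.ne'; rfl
  | succ m ih =>
    obtain ⟨r, rfl⟩ := Nat.exists_eq_succ_of_ne_zero (Nat.ne_zero_of_lt h)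
    rw [Nat.succ_eq_add_one, qChoose_succ_succ, ih (by omega), ih (by omega)]; simp

@[simp] theorem qChoose_self (m : ℕ) : qChoose q m m = 1 := by
  induction m with
  | zero => rfl
  | succ m ih => rw [qChoose_succ_succ, qChoose_eq_zero q (Nat.lt_succ_self m), ih]; simp

theorem qChoose_step (m r : ℕ) (h : r ≤ m) :
    (1 - q ^ (r + 1)) * qChoose q m (r + 1) = (1 - q ^ (m - r)) * qChoose q m r := by
  induction m generalizing r with
  | zero => obtain rfl : r = 0 := by omega
            simp
  | succ m ih =>
    rcases Nat.eq_or_lt_of_le h with rfl | h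
    · rw [qChoose_eq_zero q (Nat.lt_succ_self _)]; simp
    obtain ⟨d, rfl⟩ := Nat.exists_eq_add_of_le (Nat.le_of_lt_succ h)
    cases r with
    | zero =>
      have h1 := ih 0 (by omega)
      simp only [Nat.zero_add, Nat.sub_zero, qChoose_zero_right, qChoose_succ_succ] at h1 ⊢
      rw [mul_add, h1]; ring
    | succ r =>
      have h1 := ih (r + 1) (by omega)
      have h2 := ih r (by omega)
      have e1 : r + 1 + d - (r + 1) = d := by omega
      have e2 : r + 1 + d - r = d + 1 := by omega
      have e3 : r + 1 + d + 1 - (r + 1) = d + 1 := by omega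
      rw [e1] at h1
      rw [e2] at h2
      rw [qChoose_succ_succ, qChoose_succ_succ, e1, e2, e3]
      linear_combination h1 + q ^ (d + 1) * h2

theorem qChoose_root {n : ℕ} (hq : IsPrimitiveRoot q n) {r : ℕ} (h0 : 0 < r) (h : r < n) :
    qChoose q n r = 0 := by
  obtain ⟨m, rfl⟩ := Nat.exists_eq_succ_of_ne_zero (Nat.ne_zero_of_lt h)
  obtain ⟨r, rfl⟩ := Nat.exists_eq_succ_of_ne_zero h0.ne'
  rw [Nat.succ_eq_add_one, Nat.succ_eq_add_one] at *
  have h1 := qChoose_step q m r (by omega)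
  have h2 : (1 - q ^ (r + 1)) * qChoose q (m + 1) (r + 1) = (1 - q ^ (m + 1)) * qChoose q m r := by
    have e : q ^ (m + 1) = q ^ (r + 1) * q ^ (m - r) := by rw [← pow_add]; congr 1; omega
    rw [qChoose_succ_succ, e]
    linear_combination h1
  rw [hq.pow_eq_one, sub_self, zero_mul, mul_eq_zero] at h2
  refine h2.resolve_left (sub_ne_zero.2 fun h3 => ?_)
  exact hq.pow_ne_one_of_pos_of_lt (Nat.succ_ne_zero r) h h3.symm

variable {M : Type*} [AddCommGroup M] [Module k M]

/-- `Σ_{r + s = m} [m choose r]_q F(r, s)`. -/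
def qSum (m : ℕ) (F : ℕ → ℕ → M) : M :=
  ∑ p ∈ Finset.HasAntidiagonal.antidiagonal m, qChoose q m p.1 • F p.1 p.2

theorem qSum_congr {m : ℕ} {F F' : ℕ → ℕ → M} (h : ∀ r s, r + s = m → F r s = F' r s) :
    qSum q m F = qSum q m F' :=
  Finset.sum_congr rfl fun p hp => by rw [h p.1 p.2 (Finset.HasAntidiagonal.mem_antidiagonal.1 hp)]

theorem qSum_zero_left (F : ℕ → ℕ → M) : qSum q 0 F = F 0 0 := by simp [qSum]

theorem qSum_add (m : ℕ) (F F' : ℕ → ℕ → M) :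
    qSum q m (fun r s => F r s + F' r s) = qSum q m F + qSum q m F' := by
  simp [qSum, Finset.sum_add_distrib]

theorem qSum_smul (m : ℕ) (c : k) (F : ℕ → ℕ → M) :
    qSum q m (fun r s => c • F r s) = c • qSum q m F := by
  simp only [qSum, Finset.smul_sum]
  exact Finset.sum_congr rfl fun p _ => smul_comm _ _ _

theorem map_qSum {N : Type*} [AddCommGroup N] [Module k N] (φ : M →ₗ[k] N) (m : ℕ)
    (F : ℕ → ℕ → M) : φ (qSum q m F) = qSum q m fun r s => φ (F r s) := by
  simp [qSum]

theorem map_qSum₂ {N N' : Type*} [AddCommGroup N] [Module k N] [AddCommGroup N'] [Module k N']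
    (φ : M →ₗ[k] N →ₗ[k] N') (a b : ℕ) (F : ℕ → ℕ → M) (F' : ℕ → ℕ → N) :
    φ (qSum q a F) (qSum q b F') =
      qSum q a fun r s => qSum q b fun r' s' => φ (F r s) (F' r' s') := by
  exact map_qSum q (φ.flip (qSum q b F')) a F |>.trans
    (qSum_congr q fun r s _ => by rw [LinearMap.flip_apply, map_qSum])

theorem qSum_eq_zero {m : ℕ} {F : ℕ → ℕ → M} (h : ∀ r s, r + s = m → F r s = 0) :
    qSum q m F = 0 :=
  Finset.sum_eq_zero fun p hp => by rw [h p.1 p.2 (Finset.HasAntidiagonal.mem_antidiagonal.1 hp), smul_zero]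

theorem qSum_single {m : ℕ} {F : ℕ → ℕ → M} (r s : ℕ) (h : r + s = m)
    (h0 : ∀ r' s', r' + s' = m → r' ≠ r → F r' s' = 0) :
    qSum q m F = qChoose q m r • F r s := by
  rw [qSum, Finset.sum_eq_single (r, s)]
  · rintro ⟨r', s'⟩ hp hne
    rw [Finset.HasAntidiagonal.mem_antidiagonal] at hp
    have : r' ≠ r := by
      rintro rfl
      exact hne (by congr 1; simp only at hp; omega)
    rw [h0 r' s' hp this, smul_zero]
  · intro hn; exact absurd (Finset.HasAntidiagonal.mem_antidiagonal.2 h) hn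

/-- The `q`-Pascal rule. -/
theorem qSum_succ (m : ℕ) (F : ℕ → ℕ → M) :
    qSum q (m + 1) F = qSum q m fun r s => F r (s + 1) + q ^ s • F (r + 1) s := by
  simp only [qSum, Finset.Nat.sum_antidiagonal_eq_sum_range_succ_mk]
  rw [Finset.sum_range_succ']
  have h1 : ∀ r ∈ Finset.range (m + 1),
      qChoose q (m + 1) (r + 1) • F (r + 1) (m + 1 - (r + 1)) =
      qChoose q m (r + 1) • F (r + 1) (m - r) + qChoose q m r • q ^ (m - r) • F (r + 1) (m - r) := by
    intro r _
    rw [qChoose_succ_succ, add_smul, Nat.add_sub_add_right, smul_smul, mul_comm]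
  rw [Finset.sum_congr rfl h1, Finset.sum_add_distrib]
  have h2 : ∑ r ∈ Finset.range (m + 1), qChoose q m (r + 1) • F (r + 1) (m - r) +
      qChoose q m 0 • F 0 (m + 1) =
      ∑ r ∈ Finset.range (m + 1), qChoose q m r • F r (m - r + 1) := by
    have h3 := Finset.sum_range_succ' (fun r => qChoose q m r • F r (m + 1 - r)) (m + 1)
    rw [Finset.sum_range_succ, qChoose_eq_zero q (Nat.lt_succ_self m), zero_smul, add_zero] at h3
    simp only [Nat.add_sub_add_right, Nat.sub_zero] at h3
    rw [← h3]
    refine Finset.sum_congr rfl fun r hr => ?_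
    rw [Nat.sub_add_comm (Nat.lt_succ_iff.1 (Finset.mem_range.1 hr))]
  simp only [smul_add, Finset.sum_add_distrib]
  rw [← h2]
  simp only [qChoose_zero_right, Nat.sub_zero]
  abel

/-- The second form of the `q`-Pascal rule. -/
theorem qSum_succ' (m : ℕ) (F : ℕ → ℕ → M) :
    qSum q (m + 1) F = qSum q m fun r s => q ^ r • F r (s + 1) + F (r + 1) s := by
  induction m generalizing F with
  | zero => rw [qSum_succ, qSum_zero_left, qSum_zero_left]; simp
  | succ m ih =>
    rw [qSum_succ, ih, qSum_succ]
    refine qSum_congr q fun r s _ => ?_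
    simp only [smul_add, smul_smul, ← pow_add]
    rw [show r + (s + 1) = s + (r + 1) by omega]
    abel

theorem qSum_qSum_add (a b : ℕ) (F : ℕ → ℕ → M) :
    qSum q a (fun r s => qSum q b fun r' s' => q ^ (s * r') • F (r + r') (s + s')) =
      qSum q (a + b) F := by
  induction b generalizing F with
  | zero => simp [qSum_zero_left]
  | succ b ih =>
    rw [← add_assoc, qSum_succ q (a + b), ← ih]
    refine qSum_congr q fun r s _ => ?_
    rw [qSum_succ]
    refine qSum_congr q fun r' s' _ => ?_
    simp only [smul_add, smul_smul, ← pow_add, add_assoc]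
    rw [show s' + s * (r' + 1) = s * r' + (s + s') by ring]

theorem qSum_assoc (m : ℕ) (F : ℕ → ℕ → ℕ → M) :
    qSum q m (fun r s => qSum q r fun a b => F a b s) =
      qSum q m fun a s => qSum q s fun b c => F a b c := by
  induction m generalizing F with
  | zero => simp [qSum_zero_left]
  | succ m ih =>
    rw [qSum_succ, qSum_succ]
    have hl : (fun r s => qSum q r (fun a b => F a b (s + 1)) +
        q ^ s • qSum q (r + 1) fun a b => F a b s) = fun r s => qSum q r fun a b =>
          F a b (s + 1) + q ^ s • (F a (b + 1) s + q ^ b • F (a + 1) b s) := by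
      funext r s
      rw [qSum_succ, ← qSum_smul, ← qSum_add]
    rw [hl, ih fun a b s => F a b (s + 1) + q ^ s • (F a (b + 1) s + q ^ b • F (a + 1) b s)]
    refine qSum_congr q fun a s _ => ?_
    rw [qSum_succ, ← qSum_smul, ← qSum_add]
    refine qSum_congr q fun b c hbc => ?_
    subst hbc
    simp only [smul_add, smul_smul, ← pow_add]
    rw [add_comm c b]
    abel

/-- Terms with `r ≥ n` or `s ≥ n` being zero, the sum vanishes from `n` on. -/
theorem qSum_root {n : ℕ} (hn : 0 < n) (hq : IsPrimitiveRoot q n) {m : ℕ} (hm : n ≤ m)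
    (F : ℕ → ℕ → M) (h1 : ∀ r s, n ≤ r → F r s = 0) (h2 : ∀ r s, n ≤ s → F r s = 0) :
    qSum q m F = 0 := by
  obtain ⟨b, rfl⟩ := Nat.exists_eq_add_of_le hm
  rw [← qSum_qSum_add]
  refine Finset.sum_eq_zero fun p hp => ?_
  have hp := Finset.HasAntidiagonal.mem_antidiagonal.1 hp
  by_cases hr : p.1 = 0
  · beta_reduce; rw [qSum_eq_zero, smul_zero]
    intro r s _
    rw [h2 _ _ (by omega), smul_zero]
  by_cases hr' : p.1 = n
  · beta_reduce; rw [qSum_eq_zero, smul_zero]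
    intro r s _
    rw [h1 _ _ (by omega), smul_zero]
  rw [qChoose_root q hq (by omega) (by omega), zero_smul]

end Gauss

/-! ### The crown quiver and the Taft categories -/

section Taft

/-- The cyclic group `C_n`, which is the set of vertices of the crown. -/
def Crown (n : ℕ) : Type := Multiplicative (ZMod n)

namespace Crown

variable (n : ℕ)

instance : CommGroup (Crown n) := inferInstanceAs (CommGroup (Multiplicative (ZMod n)))
instance : DecidableEq (Crown n) := inferInstanceAs (DecidableEq (Multiplicative (ZMod n)))
instance [NeZero n] : Fintype (Crown n) := inferInstanceAs (Fintype (Multiplicative (ZMod n)))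

/-- The generator `t` of `C_n`. -/
def t : Crown n := Multiplicative.ofAdd (1 : ZMod n)

theorem t_pow_self : t n ^ n = 1 := by
  change Multiplicative.ofAdd (n • (1 : ZMod n)) = Multiplicative.ofAdd 0
  simp

/-- The crown quiver: exactly one arrow `a_u : u ⟶ t u` for each `u`. -/
instance : Quiver (Crown n) where
  Hom x y := PLift (t n * x = y)

variable {n}

theorem pow_length {x y : Crown n} (p : Quiver.Path x y) : t n ^ p.length * x = y := by
  induction p with
  | nil => simp
  | cons p a ih => rw [Quiver.Path.length_cons, pow_succ', mul_assoc, ih, a.down]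

theorem path_eq {x y : Crown n} (p p' : Quiver.Path x y) (h : p.length = p'.length) : p = p' := by
  induction p with
  | nil => cases p' with
    | nil => rfl
    | cons p' a' => simp at h
  | @cons b c p a ih => cases p' with
    | nil => simp at h
    | @cons b' _ p' a' =>
      obtain rfl : b = b' := mul_left_cancel (a.down.trans a'.down.symm)
      rw [ih p' (by simpa using h), Subsingleton.elim (α := PLift _) a a']

theorem exists_path (m : ℕ) (x : Crown n) : ∃ p : Quiver.Path x (t n ^ m * x), p.length = m := by
  suffices ∀ y, y = t n ^ m * x → ∃ p : Quiver.Path x y, p.length = m from this _ rfl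
  induction m with
  | zero => rintro y hy; obtain rfl : x = y := by simpa using hy.symm
            exact ⟨.nil, rfl⟩
  | succ m ih =>
    rintro y hy
    obtain ⟨p, hp⟩ := ih _ rfl
    exact ⟨p.cons ⟨by rw [hy, pow_succ', mul_assoc]⟩, by simp [hp]⟩

end Crown

variable (k : Type u) [Field k] (n : ℕ)

/-- The two-sided ideal of the crown category (the free `k`-category on the crown quiver) generated
by the paths of length `n`. -/
def crownIdeal : LinIdeal k (FreeCat k (Crown n)) :=
  LinIdeal.span fun x y => {f | ∃ p : Quiver.Path (V := Crown n) x y, p.length = n ∧ f = freePath k p}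

/-- The `k`-category underlying the Taft categories `T_{n,q}`; its objects are the elements of
`C_n`. -/
def Taft : Type := (crownIdeal k n).Quot

namespace Taft

instance : CommGroup (Taft k n) := inferInstanceAs (CommGroup (Crown n))
instance : DecidableEq (Taft k n) := inferInstanceAs (DecidableEq (Crown n))
instance [NeZero n] : Fintype (Taft k n) := inferInstanceAs (Fintype (Crown n))
instance : Category.{u} (Taft k n) := inferInstanceAs (Category (crownIdeal k n).Quot)
instance : Preadditive (Taft k n) := inferInstanceAs (Preadditive (crownIdeal k n).Quot)
instance : Linear k (Taft k n) := inferInstanceAs (Linear k (crownIdeal k n).Quot)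


variable {k n}

/-- The element of `C_n` which is the given object. -/
def toCrown (x : Taft k n) : Crown n := x

variable (k n) in
/-- The generator `t` of `C_n`, as an object. -/
def t : Taft k n := Crown.t n

theorem t_pow_self : t k n ^ n = 1 := Crown.t_pow_self n

/-- The class of a path of the crown. -/
def ofPath {x y : Taft k n} (p : Quiver.Path x.toCrown y.toCrown) : x ⟶ y :=
  (crownIdeal k n).cls (freePath (V := Crown n) (x := x.toCrown) (y := y.toCrown) k p)

/-- The generating morphism `a_x : x ⟶ t x`. -/
def arrow (x : Taft k n) : x ⟶ t k n * x :=
  ofPath (Quiver.Hom.toPath (V := Crown n) (a := x.toCrown) (b := (t k n * x).toCrown) (PLift.up rfl))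

open scoped Classical in
/-- The class of the path of length `m` from `x` to `y` if there is one, and `0` otherwise. -/
def P (m : ℕ) (x y : Taft k n) : x ⟶ y :=
  if h : ∃ p : Quiver.Path x.toCrown y.toCrown, p.length = m then ofPath h.choose else 0

theorem P_eq {m : ℕ} {x y : Taft k n} (p : Quiver.Path x.toCrown y.toCrown) (hp : p.length = m) :
    P m x y = ofPath p := by
  have h : ∃ p' : Quiver.Path x.toCrown y.toCrown, p'.length = m := ⟨p, hp⟩
  rw [P, dif_pos h, Crown.path_eq _ _ (h.choose_spec.trans hp.symm)]

theorem P_of_ne {m : ℕ} {x y : Taft k n} (h : t k n ^ m * x ≠ y) : P m x y = 0 := by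
  rw [P, dif_neg]
  rintro ⟨p, rfl⟩
  exact h (Crown.pow_length p)

theorem exists_path {m : ℕ} {x y : Taft k n} (h : t k n ^ m * x = y) :
    ∃ p : Quiver.Path x.toCrown y.toCrown, p.length = m := by
  subst h
  exact Crown.exists_path m x.toCrown

theorem P_comp (a b : ℕ) (x z : Taft k n) :
    P a x (t k n ^ a * x) ≫ P b (t k n ^ a * x) z = P (a + b) x z := by
  by_cases h : t k n ^ b * (t k n ^ a * x) = z
  · obtain ⟨p, hp⟩ := exists_path (rfl : t k n ^ a * x = _)
    obtain ⟨p', hp'⟩ := exists_path h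
    have h3 : (p.comp p').length = a + b := by rw [Quiver.Path.length_comp, hp, hp']
    rw [P_eq _ h3, P_eq _ hp, P_eq _ hp']
    unfold ofPath
    rw [freePath_comp]
    rfl
  · rw [P_of_ne h, Limits.comp_zero, P_of_ne]
    rwa [pow_add, mul_comm (_ ^ a), mul_assoc]


/-- The linear map sending a path of length `m` to `v m`. -/
def crownLift {M : Type*} [AddCommGroup M] [Module k M] (x y : Crown n) (v : ℕ → M) :
    (freeObj k x ⟶ freeObj k y) →ₗ[k] M :=
  freeLift fun p : Quiver.Path x y => v p.length

theorem crownIdeal_le (x y : Crown n) {M : Type*} [AddCommGroup M] [Module k M] (v : ℕ → M)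
    (hv : ∀ m, n ≤ m → v m = 0) : (crownIdeal k n).hom (freeObj k x) (freeObj k y) ≤
      LinearMap.ker (crownLift x y v) := by
  let S : ∀ x y : Crown n, Submodule k (freeObj k x ⟶ freeObj k y) := fun x y =>
    Submodule.span k {f | ∃ p : Quiver.Path x y, n ≤ p.length ∧ f = freePath k p}
  have hl : ∀ {x y z : Crown n} (f : freeObj k x ⟶ freeObj k y) (g : freeObj k y ⟶ freeObj k z),
      g ∈ S y z → f ≫ g ∈ S x z := by
    intro x y z f g hg
    induction hg using Submodule.span_induction with
    | mem g hg =>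
      obtain ⟨p, hp, rfl⟩ := hg
      have : (S x z).mkQ ∘ₗ Linear.rightComp k (freeObj k x) (freePath k p) = 0 := by
        refine free_ext fun p' => ?_
        have : freePath k (p'.comp p) ∈ S x z := Submodule.subset_span
          ⟨_, by rw [Quiver.Path.length_comp]; omega, rfl⟩
        rw [freePath_comp] at this
        simpa using this
      simpa using LinearMap.congr_fun this f
    | zero => rw [Limits.comp_zero]; exact zero_mem _
    | add g g' _ _ h h' => rw [Preadditive.comp_add]; exact add_mem h h'
    | smul c g _ h => rw [Linear.comp_smul]; exact Submodule.smul_mem _ c h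
  have hr : ∀ {x y z : Crown n} (f : freeObj k x ⟶ freeObj k y) (g : freeObj k y ⟶ freeObj k z),
      f ∈ S x y → f ≫ g ∈ S x z := by
    intro x y z f g hf
    induction hf using Submodule.span_induction with
    | mem f hf =>
      obtain ⟨p, hp, rfl⟩ := hf
      have : (S x z).mkQ ∘ₗ Linear.leftComp k (freeObj k z) (freePath k p) = 0 := by
        refine free_ext fun p' => ?_
        have : freePath k (p.comp p') ∈ S x z := Submodule.subset_span
          ⟨_, by rw [Quiver.Path.length_comp]; omega, rfl⟩
        rw [freePath_comp] at this
        simpa using this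
      simpa using LinearMap.congr_fun this g
    | zero => rw [Limits.zero_comp]; exact zero_mem _
    | add f f' _ _ h h' => rw [Preadditive.add_comp]; exact add_mem h h'
    | smul c f _ h => rw [Linear.smul_comp]; exact Submodule.smul_mem _ c h
  let I : LinIdeal k (FreeCat k (Crown n)) := ⟨fun x y => S x y, hl, hr⟩
  have base : ∀ (x y : Crown n) (p : Quiver.Path x y), p.length = n → freePath k p ∈ S x y :=
    fun x y p hp => Submodule.subset_span ⟨p, hp.ge, rfl⟩
  have key : ∀ x y : Crown n, S x y ≤ LinearMap.ker (crownLift x y v) := by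
    intro x y
    refine Submodule.span_le.2 ?_
    rintro f ⟨p, hp, rfl⟩
    refine LinearMap.mem_ker.2 ?_
    rw [crownLift, freeLift_path, hv _ hp]
  refine (LinIdeal.span_le _ I ?_ (freeObj k x) (freeObj k y)).trans ?_
  · rintro x y f ⟨p, hp, rfl⟩
    exact base x y p hp
  · exact key x y

/-- The linear map on `Hom(x, y)` which sends the class of a path of length `m` to `v m`. -/
def desc {M : Type*} [AddCommGroup M] [Module k M] (x y : Taft k n) (v : ℕ → M)
    (hv : ∀ m, n ≤ m → v m = 0) : (x ⟶ y) →ₗ[k] M :=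
  (crownIdeal k n).lift (crownLift x.toCrown y.toCrown v)
    (crownIdeal_le x.toCrown y.toCrown v hv)

theorem desc_P {M : Type*} [AddCommGroup M] [Module k M] {x y : Taft k n} (v : ℕ → M)
    (hv : ∀ m, n ≤ m → v m = 0) {m : ℕ} (h : t k n ^ m * x = y) :
    desc x y v hv (P m x y) = v m := by
  obtain ⟨p, rfl⟩ := exists_path h
  rw [P_eq p rfl]
  exact ((crownIdeal k n).lift_cls _ _ _).trans (freeLift_path (k := k) (fun p => v p.length) p)

theorem hom_ext {M : Type*} [AddCommGroup M] [Module k M] {x y : Taft k n}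
    {φ ψ : (x ⟶ y) →ₗ[k] M}
    (h : ∀ m, t k n ^ m * x = y → φ (P m x y) = ψ (P m x y)) : φ = ψ := by
  have h1 : φ ∘ₗ (crownIdeal k n).cls (x := freeObj k x.toCrown) (y := freeObj k y.toCrown) =
      ψ ∘ₗ (crownIdeal k n).cls (x := freeObj k x.toCrown) (y := freeObj k y.toCrown) := by
    refine free_ext fun p => ?_
    have h2 := h p.length (Crown.pow_length p)
    rw [P_eq p rfl] at h2
    exact h2
  refine LinearMap.ext fun f => ?_
  obtain ⟨f, rfl⟩ := (crownIdeal k n).cls_surjective f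
  exact LinearMap.congr_fun h1 f

theorem P_of_le {m : ℕ} (hm : n ≤ m) (x y : Taft k n) : P m x y = 0 := by
  by_cases h : t k n ^ m * x = y
  · have h1 : t k n ^ (m - n) * x = y := by
      rw [← h, ← Nat.sub_add_cancel hm, pow_add, t_pow_self, mul_one, Nat.sub_add_cancel hm]
    obtain ⟨p, hp⟩ := exists_path h1
    obtain ⟨p', hp'⟩ := exists_path (show t k n ^ n * y = y by rw [t_pow_self, one_mul])
    have h2 : (p.comp p').length = m := by rw [Quiver.Path.length_comp, hp, hp']; omega
    rw [P_eq _ h2]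
    refine ((crownIdeal k n).cls_eq_zero _).2 ?_
    rw [freePath_comp]
    exact (crownIdeal k n).comp_mem_left _ _ (LinIdeal.subset_span _ _ _ ⟨p', hp', rfl⟩)
  · exact P_of_ne h

theorem P_zero (x : Taft k n) : P 0 x x = 𝟙 x := by
  rw [P_eq (m := 0) (Quiver.Path.nil : Quiver.Path x.toCrown x.toCrown) rfl]
  unfold ofPath
  rw [freePath_nil]
  rfl

theorem P_one (x : Taft k n) : P 1 x (t k n * x) = arrow x := P_eq _ rfl

theorem P_eqToHom {x y z : Taft k n} (m : ℕ) (h : y = z) : P m x y ≫ eqToHom h = P m x z := by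
  subst h; simp

/-! #### The Hopf structure of `T_{n,q}` -/

/-- `q ^ i` for the object `t ^ i`. -/
def chi (q : k) (x : Taft k n) : k := q ^ (Multiplicative.toAdd (α := ZMod n) x).val

variable {q : k}

theorem chi_one : chi q (1 : Taft k n) = 1 := by
  change q ^ (0 : ZMod n).val = 1
  simp

theorem chi_mul [NeZero n] (hq : IsPrimitiveRoot q n) (x y : Taft k n) : chi q (x * y) = chi q x * chi q y := by
  change q ^ ((Multiplicative.toAdd (α := ZMod n) x) + (Multiplicative.toAdd (α := ZMod n) y)).val = _
  rw [ZMod.val_add, ← pow_eq_pow_mod _ hq.pow_eq_one, pow_add]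
  rfl

theorem chi_t (hq : IsPrimitiveRoot q n) : chi q (t k n) = q := by
  change q ^ (1 : ZMod n).val = q
  rw [ZMod.val_one_eq_one_mod, ← pow_eq_pow_mod _ hq.pow_eq_one, pow_one]

theorem chi_t_pow [NeZero n] (hq : IsPrimitiveRoot q n) (m : ℕ) : chi q (t k n ^ m) = q ^ m := by
  induction m with
  | zero => simpa using chi_one
  | succ m ih => rw [pow_succ, chi_mul hq, ih, chi_t hq, pow_succ]


/-- The term `q^(r i) P_r ⊗ P_s`, where `x₁ = t ^ i`. -/
def comulTerm (q : k) (x₂ x₁ y₂ y₁ : Taft k n) (r s : ℕ) : (x₂ ⟶ y₂) ⊗[k] (x₁ ⟶ y₁) :=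
  chi q x₁ ^ r • (P r x₂ y₂ ⊗ₜ[k] P s x₁ y₁)

theorem comulTerm_root [NeZero n] (hq : IsPrimitiveRoot q n) (x₂ x₁ y₂ y₁ : Taft k n) (m : ℕ)
    (hm : n ≤ m) : qSum q m (comulTerm q x₂ x₁ y₂ y₁) = 0 := by
  refine qSum_root q (NeZero.pos n) hq hm _ ?_ ?_
  · intro r s h
    rw [comulTerm, P_of_le h, TensorProduct.zero_tmul, smul_zero]
  · intro r s h
    rw [comulTerm, P_of_le h, TensorProduct.tmul_zero, smul_zero]

/-- The comultiplication of `T_{n,q}`: the path of length `m` is sent to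
`Σ_{r + s = m} [m choose r]_q q^(r i) P_r ⊗ P_s`. This is the multiplicative map given on the
generating morphisms by `taft_comul_arrow`. -/
def comul [NeZero n] (hq : IsPrimitiveRoot q n) (x y x₂ x₁ y₂ y₁ : Taft k n) :
    (x ⟶ y) →ₗ[k] (x₂ ⟶ y₂) ⊗[k] (x₁ ⟶ y₁) :=
  desc x y (fun m => qSum q m (comulTerm q x₂ x₁ y₂ y₁)) (comulTerm_root hq x₂ x₁ y₂ y₁)

theorem comul_P [NeZero n] (hq : IsPrimitiveRoot q n) (m : ℕ) {x y x₂ x₁ y₂ y₁ : Taft k n}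
    (hx : x₂ * x₁ = x) (hy : y₂ * y₁ = y) :
    comul hq x y x₂ x₁ y₂ y₁ (P m x y) = qSum q m (comulTerm q x₂ x₁ y₂ y₁) := by
  by_cases h : t k n ^ m * x = y
  · exact desc_P _ _ h
  · rw [P_of_ne h, map_zero, qSum_eq_zero]
    intro r s hrs
    rw [comulTerm]
    by_cases hr : t k n ^ r * x₂ = y₂
    · rw [P_of_ne (x := x₁) (y := y₁), TensorProduct.tmul_zero, smul_zero]
      intro hs
      refine h ?_
      rw [← hx, ← hy, ← hr, ← hs, ← hrs, pow_add, mul_mul_mul_comm]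
    · rw [P_of_ne hr, TensorProduct.zero_tmul, smul_zero]

/-- The coefficient of the antipode: `∏_{j < m} (- q^(j + 1) q^i)` for the path of length `m`
starting at `x = t ^ i`. -/
def antiCoeff (q : k) (x : Taft k n) (m : ℕ) : k := ∏ j ∈ Finset.range m, -(q ^ (j + 1) * chi q x)

theorem antiCoeff_succ (x : Taft k n) (m : ℕ) :
    antiCoeff q x (m + 1) = antiCoeff q x m * -(q ^ (m + 1) * chi q x) :=
  Finset.prod_range_succ _ _

theorem antiCoeff_add [NeZero n] (hq : IsPrimitiveRoot q n) (x : Taft k n) (a b : ℕ) :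
    antiCoeff q x (a + b) = antiCoeff q x a * antiCoeff q (t k n ^ a * x) b := by
  induction b with
  | zero => simp [antiCoeff]
  | succ b ih =>
    rw [← add_assoc, antiCoeff_succ, ih, antiCoeff_succ, chi_mul hq, chi_t_pow hq]
    ring

/-- The antipode of `T_{n,q}`, given on the generating morphisms by `taft_antipode_arrow`. -/
def antipode (q : k) (x y : Taft k n) : (x ⟶ y) →ₗ[k] (y⁻¹ ⟶ x⁻¹) :=
  desc x y (fun m => antiCoeff q x m • P m y⁻¹ x⁻¹) (fun m hm => by rw [P_of_le hm, smul_zero])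

theorem antipode_P (m : ℕ) (x y : Taft k n) :
    antipode q x y (P m x y) = antiCoeff q x m • P m y⁻¹ x⁻¹ := by
  by_cases h : t k n ^ m * x = y
  · exact desc_P _ _ h
  · rw [P_of_ne h, map_zero, P_of_ne, smul_zero]
    intro h'
    refine h ?_
    rw [mul_inv_eq_iff_eq_mul] at h'
    rw [h', mul_comm x⁻¹, inv_mul_cancel_right]

/-- The counit of `T_{n,q}`. -/
def counit [NeZero n] (x y : Taft k n) : (x ⟶ y) →ₗ[k] k :=
  desc x y (fun m => if x = 1 ∧ y = 1 ∧ m = 0 then 1 else 0) (fun m hm => by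
    rw [if_neg]
    rintro ⟨_, _, rfl⟩
    exact NeZero.ne n (Nat.le_zero.1 hm))

theorem counit_P [NeZero n] (m : ℕ) (x y : Taft k n) :
    counit x y (P m x y) = if x = 1 ∧ y = 1 ∧ m = 0 then 1 else 0 := by
  by_cases h : t k n ^ m * x = y
  · exact desc_P _ _ h
  · rw [P_of_ne h, map_zero, if_neg]
    rintro ⟨rfl, rfl, rfl⟩
    simp at h

theorem comul_comp [NeZero n] (hq : IsPrimitiveRoot q n) {x y z : Taft k n} (f : x ⟶ y) (g : y ⟶ z)
    (x₂ x₁ z₂ z₁ : Taft k n) (hx : x₂ * x₁ = x) (hz : z₂ * z₁ = z) :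
    comul hq x z x₂ x₁ z₂ z₁ (f ≫ g) =
      ∑ y₂ : Taft k n, TensorProduct.map₂ (Linear.comp (S := k) x₂ y₂ z₂)
        (Linear.comp (S := k) x₁ (y₂⁻¹ * y) z₁)
        (comul hq x y x₂ x₁ y₂ (y₂⁻¹ * y) f) (comul hq y z y₂ (y₂⁻¹ * y) z₂ z₁ g) := by
  have key : (Linear.comp (S := k) x y z).compr₂ (comul hq x z x₂ x₁ z₂ z₁) =
      ∑ y₂ : Taft k n, (TensorProduct.map₂ (Linear.comp (S := k) x₂ y₂ z₂)
        (Linear.comp (S := k) x₁ (y₂⁻¹ * y) z₁)).compl₁₂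
        (comul hq x y x₂ x₁ y₂ (y₂⁻¹ * y)) (comul hq y z y₂ (y₂⁻¹ * y) z₂ z₁) := by
    refine hom_ext fun a ha => hom_ext fun b hb => ?_
    subst ha
    rw [LinearMap.compr₂_apply, Linear.comp_apply, Linear.leftComp_apply, P_comp, comul_P hq _ hx hz,
      ← qSum_qSum_add, LinearMap.sum_apply, LinearMap.sum_apply]
    have h1 : ∀ y₂ : Taft k n, comul hq x (t k n ^ a * x) x₂ x₁ y₂ (y₂⁻¹ * (t k n ^ a * x))
        (P a x (t k n ^ a * x)) =
        qSum q a (comulTerm q x₂ x₁ y₂ (y₂⁻¹ * (t k n ^ a * x))) := fun y₂ =>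
      comul_P hq a hx (mul_inv_cancel_left y₂ _)
    have h2 : ∀ y₂ : Taft k n, comul hq (t k n ^ a * x) z y₂ (y₂⁻¹ * (t k n ^ a * x)) z₂ z₁
        (P b (t k n ^ a * x) z) =
        qSum q b (comulTerm q y₂ (y₂⁻¹ * (t k n ^ a * x)) z₂ z₁) := fun y₂ =>
      comul_P hq b (mul_inv_cancel_left y₂ _) hz
    simp only [LinearMap.compl₁₂_apply, h1, h2]
    have h3 : ∀ y₂ : Taft k n, TensorProduct.map₂ (Linear.comp (S := k) x₂ y₂ z₂)
        (Linear.comp (S := k) x₁ (y₂⁻¹ * (t k n ^ a * x)) z₁)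
        (qSum q a (comulTerm q x₂ x₁ y₂ (y₂⁻¹ * (t k n ^ a * x))))
        (qSum q b (comulTerm q y₂ (y₂⁻¹ * (t k n ^ a * x)) z₂ z₁)) =
        qSum q a fun r s => if y₂ = t k n ^ r * x₂ then
          qSum q b fun r' s' => q ^ (s * r') • comulTerm q x₂ x₁ z₂ z₁ (r + r') (s + s') else 0 := by
      intro y₂
      rw [map_qSum₂]
      refine qSum_congr q fun r s hrs => ?_
      split_ifs with h
      · refine qSum_congr q fun r' s' _ => ?_
        have hw : y₂⁻¹ * (t k n ^ a * x) = t k n ^ s * x₁ := by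
          rw [inv_mul_eq_iff_eq_mul, h, ← hx, ← hrs, pow_add, mul_mul_mul_comm]
        rw [hw, h, comulTerm, comulTerm, comulTerm, map_smul, map_smul, LinearMap.smul_apply,
          TensorProduct.map₂_apply_tmul]
        simp only [Linear.comp_apply, TensorProduct.map_tmul, Linear.leftComp_apply, P_comp, smul_smul]
        rw [chi_mul hq, chi_t_pow hq, mul_pow, ← pow_mul, pow_add]
        congr 1
        ring
      · refine qSum_eq_zero q fun r' s' _ => ?_
        rw [comulTerm, P_of_ne (Ne.symm h), TensorProduct.zero_tmul, smul_zero, map_zero,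
          LinearMap.zero_apply]
    rw [Finset.sum_congr rfl fun y₂ _ => h3 y₂]
    simp only [qSum]
    rw [Finset.sum_comm]
    refine Finset.sum_congr rfl fun p _ => ?_
    rw [← Finset.smul_sum, Finset.sum_ite_eq' Finset.univ, if_pos (Finset.mem_univ _)]
  have := LinearMap.congr_fun (LinearMap.congr_fun key f) g
  rw [LinearMap.sum_apply, LinearMap.sum_apply] at this
  exact this


theorem comul_id [NeZero n] (hq : IsPrimitiveRoot q n) {x : Taft k n} (x₂ x₁ : Taft k n)
    (hx : x₂ * x₁ = x) : comul hq x x x₂ x₁ x₂ x₁ (𝟙 x) = 𝟙 x₂ ⊗ₜ[k] 𝟙 x₁ := by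
  rw [← P_zero, comul_P hq 0 hx hx, qSum_zero_left, comulTerm, P_zero, P_zero, pow_zero, one_smul]

theorem comul_id_of_ne [NeZero n] (hq : IsPrimitiveRoot q n) {x : Taft k n}
    (x₂ x₁ y₂ y₁ : Taft k n) (hx : x₂ * x₁ = x) (hy : y₂ * y₁ = x) (h : x₂ ≠ y₂) :
    comul hq x x x₂ x₁ y₂ y₁ (𝟙 x) = 0 := by
  rw [← P_zero, comul_P hq 0 hx hy, qSum_zero_left, comulTerm, P_of_ne (x := x₂),
    TensorProduct.zero_tmul, smul_zero]
  rwa [pow_zero, one_mul]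

theorem counit_comp [NeZero n] {x y z : Taft k n} (f : x ⟶ y) (g : y ⟶ z) :
    counit x z (f ≫ g) = counit y z g * counit x y f := by
  have key : (Linear.comp (S := k) x y z).compr₂ (counit x z) =
      ((LinearMap.mul k k).compl₁₂ (counit y z) (counit x y)).flip := by
    refine hom_ext fun a ha => hom_ext fun b hb => ?_
    subst ha
    rw [LinearMap.compr₂_apply, Linear.comp_apply, Linear.leftComp_apply, P_comp, counit_P,
      LinearMap.flip_apply, LinearMap.compl₁₂_apply, counit_P, counit_P, LinearMap.mul_apply']
    by_cases hb0 : b = 0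
    · by_cases ha0 : a = 0
      · subst ha0 hb0; simp only [pow_zero, one_mul] at *; subst hb; simp
      · simp [ha0]
    · simp [hb0]
  exact LinearMap.congr_fun (LinearMap.congr_fun key f) g

theorem counit_id [NeZero n] : counit 1 1 (𝟙 (1 : Taft k n)) = 1 := by
  rw [← P_zero, counit_P]; simp

theorem counit_eq_zero [NeZero n] {x y : Taft k n} (f : x ⟶ y) (h : x ≠ 1 ∨ y ≠ 1) :
    counit x y f = 0 := by
  have : counit x y = 0 := hom_ext fun m _ => by
    rw [counit_P, if_neg, LinearMap.zero_apply]
    tauto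
  rw [this, LinearMap.zero_apply]

theorem antipode_comp [NeZero n] (hq : IsPrimitiveRoot q n) {x y z : Taft k n} (f : x ⟶ y)
    (g : y ⟶ z) : antipode q x z (f ≫ g) = antipode q y z g ≫ antipode q x y f := by
  have key : (Linear.comp (S := k) x y z).compr₂ (antipode q x z) =
      ((Linear.comp (S := k) z⁻¹ y⁻¹ x⁻¹).compl₁₂ (antipode q y z) (antipode q x y)).flip := by
    refine hom_ext fun a ha => hom_ext fun b hb => ?_
    subst ha hb
    rw [LinearMap.compr₂_apply, Linear.comp_apply, Linear.leftComp_apply, P_comp, antipode_P,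
      LinearMap.flip_apply, LinearMap.compl₁₂_apply, antipode_P, antipode_P, map_smul, map_smul,
      LinearMap.smul_apply, Linear.comp_apply, Linear.leftComp_apply]
    have h : (t k n ^ a * x)⁻¹ = t k n ^ b * (t k n ^ b * (t k n ^ a * x))⁻¹ := by
      rw [mul_inv_rev (t k n ^ b), mul_left_comm, mul_inv_cancel, mul_one]
    have h2 := P_comp (k := k) b a (t k n ^ b * (t k n ^ a * x))⁻¹ x⁻¹
    rw [← h] at h2
    rw [h2, smul_smul, antiCoeff_add hq, add_comm b a]
  exact LinearMap.congr_fun (LinearMap.congr_fun key f) g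

theorem antipode_id (x : Taft k n) : antipode q x x (𝟙 x) = 𝟙 x⁻¹ := by
  rw [← P_zero, antipode_P, P_zero, antiCoeff, Finset.prod_range_zero, one_smul]

theorem coassoc [NeZero n] (hq : IsPrimitiveRoot q n) {x y : Taft k n} (f : x ⟶ y)
    (x₃ x₂ x₁ y₃ y₂ y₁ : Taft k n) (hx : x₃ * x₂ * x₁ = x) (hy : y₃ * y₂ * y₁ = y) :
    TensorProduct.assoc k (x₃ ⟶ y₃) (x₂ ⟶ y₂) (x₁ ⟶ y₁)
      (TensorProduct.map (comul hq (x₃ * x₂) (y₃ * y₂) x₃ x₂ y₃ y₂) LinearMap.id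
        (comul hq x y (x₃ * x₂) x₁ (y₃ * y₂) y₁ f)) =
    TensorProduct.map LinearMap.id (comul hq (x₂ * x₁) (y₂ * y₁) x₂ x₁ y₂ y₁)
      (comul hq x y x₃ (x₂ * x₁) y₃ (y₂ * y₁) f) := by
  have key : (TensorProduct.assoc k (x₃ ⟶ y₃) (x₂ ⟶ y₂) (x₁ ⟶ y₁)).toLinearMap ∘ₗ
      TensorProduct.map (comul hq (x₃ * x₂) (y₃ * y₂) x₃ x₂ y₃ y₂) LinearMap.id ∘ₗ
        comul hq x y (x₃ * x₂) x₁ (y₃ * y₂) y₁ =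
    TensorProduct.map LinearMap.id (comul hq (x₂ * x₁) (y₂ * y₁) x₂ x₁ y₂ y₁) ∘ₗ
      comul hq x y x₃ (x₂ * x₁) y₃ (y₂ * y₁) := by
    refine hom_ext fun m _ => ?_
    have hl : ∀ r s, (TensorProduct.assoc k (x₃ ⟶ y₃) (x₂ ⟶ y₂) (x₁ ⟶ y₁)).toLinearMap
        (TensorProduct.map (comul hq (x₃ * x₂) (y₃ * y₂) x₃ x₂ y₃ y₂) LinearMap.id
          (comulTerm q (x₃ * x₂) x₁ (y₃ * y₂) y₁ r s)) =
        qSum q r fun a b => (chi q x₁ ^ (a + b) * chi q x₂ ^ a) •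
          (P a x₃ y₃ ⊗ₜ[k] (P b x₂ y₂ ⊗ₜ[k] P s x₁ y₁)) := by
      intro r s
      rw [comulTerm, map_smul, map_smul, TensorProduct.map_tmul, comul_P hq r rfl rfl,
        LinearMap.id_apply, ← TensorProduct.mk_apply, ← LinearMap.flip_apply, map_qSum, map_qSum,
        ← qSum_smul]
      refine qSum_congr q fun a b hab => ?_
      rw [comulTerm, map_smul, map_smul, LinearMap.flip_apply, TensorProduct.mk_apply, smul_smul,
        hab, LinearEquiv.coe_coe, TensorProduct.assoc_tmul]
    have hr : ∀ a s, TensorProduct.map LinearMap.id (comul hq (x₂ * x₁) (y₂ * y₁) x₂ x₁ y₂ y₁)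
          (comulTerm q x₃ (x₂ * x₁) y₃ (y₂ * y₁) a s) =
        qSum q s fun b c => (chi q x₁ ^ (a + b) * chi q x₂ ^ a) •
          (P a x₃ y₃ ⊗ₜ[k] (P b x₂ y₂ ⊗ₜ[k] P c x₁ y₁)) := by
      intro a s
      rw [comulTerm, map_smul, TensorProduct.map_tmul, comul_P hq s rfl rfl,
        LinearMap.id_apply, ← TensorProduct.mk_apply, map_qSum, ← qSum_smul]
      refine qSum_congr q fun b c hbc => ?_
      rw [comulTerm, map_smul, TensorProduct.mk_apply, smul_smul, chi_mul hq]
      congr 1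
      ring
    rw [LinearMap.comp_apply, LinearMap.comp_apply, LinearMap.comp_apply, comul_P hq m hx hy,
      comul_P hq m ((mul_assoc _ _ _).symm.trans hx) ((mul_assoc _ _ _).symm.trans hy),
      map_qSum, map_qSum, map_qSum]
    simp only [hl, hr]
    exact qSum_assoc q m fun a b c => (chi q x₁ ^ (a + b) * chi q x₂ ^ a) •
          (P a x₃ y₃ ⊗ₜ[k] (P b x₂ y₂ ⊗ₜ[k] P c x₁ y₁))
  exact LinearMap.congr_fun key f

theorem counit_left [NeZero n] (hq : IsPrimitiveRoot q n) {x y : Taft k n} (f : x ⟶ y) :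
    TensorProduct.lid k (x ⟶ y) (TensorProduct.map (counit 1 1) LinearMap.id
      (comul hq x y 1 x 1 y f)) = f := by
  have key : (TensorProduct.lid k (x ⟶ y)).toLinearMap ∘ₗ
      TensorProduct.map (counit 1 1) LinearMap.id ∘ₗ comul hq x y 1 x 1 y = LinearMap.id := by
    refine hom_ext fun m _ => ?_
    rw [LinearMap.comp_apply, LinearMap.comp_apply, comul_P hq m (one_mul x) (one_mul y),
      map_qSum, map_qSum, qSum_single q 0 m (Nat.zero_add m)]
    · simp [comulTerm, counit_P]
    · intro r s _ hr
      simp [comulTerm, counit_P, hr]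
  exact LinearMap.congr_fun key f

theorem counit_right [NeZero n] (hq : IsPrimitiveRoot q n) {x y : Taft k n} (f : x ⟶ y) :
    TensorProduct.rid k (x ⟶ y) (TensorProduct.map LinearMap.id (counit 1 1)
      (comul hq x y x 1 y 1 f)) = f := by
  have key : (TensorProduct.rid k (x ⟶ y)).toLinearMap ∘ₗ
      TensorProduct.map LinearMap.id (counit 1 1) ∘ₗ comul hq x y x 1 y 1 = LinearMap.id := by
    refine hom_ext fun m _ => ?_
    rw [LinearMap.comp_apply, LinearMap.comp_apply, comul_P hq m (mul_one x) (mul_one y),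
      map_qSum, map_qSum, qSum_single q m 0 (Nat.add_zero m)]
    · simp [comulTerm, counit_P, chi_one]
    · intro r s hrs hr
      have : s ≠ 0 := by omega
      simp [comulTerm, counit_P, this]
  exact LinearMap.congr_fun key f


theorem antipode_left_aux [NeZero n] (hq : IsPrimitiveRoot q n) {x : Taft k n} (m : ℕ)
    (x₂ x₁ : Taft k n) (hx : x₂ * x₁ = x) (hm : t k n ^ m * x = 1) :
    ∑ y₂ : Taft k n, antipodeMulLeft k (fun {x y} => antipode q x y) x₂ x₁ y₂
      (comul hq x 1 x₂ x₁ y₂ y₂⁻¹ (P m x 1)) = if m = 0 then P 0 x₁ x₂⁻¹ else 0 := by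
  have h1 : ∀ y₂ : Taft k n, antipodeMulLeft k (fun {x y} => antipode q x y) x₂ x₁ y₂
      (comul hq x 1 x₂ x₁ y₂ y₂⁻¹ (P m x 1)) =
      qSum q m fun r s => if y₂ = t k n ^ r * x₂ then
        (chi q x₁ ^ r * antiCoeff q x₂ r) • P m x₁ x₂⁻¹ else 0 := by
    intro y₂
    rw [comul_P hq m hx (mul_inv_cancel y₂), map_qSum]
    refine qSum_congr q fun r s hrs => ?_
    rw [comulTerm, map_smul, antipodeMulLeft, TensorProduct.lift.tmul, LinearMap.comp_apply,
      antipode_P, map_smul, LinearMap.smul_apply, LinearMap.flip_apply, Linear.comp_apply,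
      Linear.leftComp_apply]
    split_ifs with h
    · have h2 : y₂⁻¹ = t k n ^ s * x₁ := by
        rw [inv_eq_iff_mul_eq_one, h, ← hm, ← hx, ← hrs, pow_add, mul_mul_mul_comm]
      rw [h2, P_comp, smul_smul, ← hrs, add_comm r s]
    · rw [P_of_ne (m := r) (x := y₂⁻¹), Limits.comp_zero, smul_zero, smul_zero]
      intro h2
      refine h ?_
      rw [mul_inv_eq_iff_eq_mul] at h2
      rw [h2, mul_comm x₂⁻¹, inv_mul_cancel_right]
  rw [Finset.sum_congr rfl fun y₂ _ => h1 y₂]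
  simp only [qSum]
  rw [Finset.sum_comm]
  simp only [← Finset.smul_sum, Finset.sum_ite_eq', Finset.mem_univ, if_true]
  change qSum q m (fun r _ => (chi q x₁ ^ r * antiCoeff q x₂ r) • P m x₁ x₂⁻¹) = _
  cases m with
  | zero => simp [qSum_zero_left, antiCoeff]
  | succ m =>
    rw [if_neg (Nat.succ_ne_zero m), qSum_succ, qSum_eq_zero]
    intro r s hrs
    have h3 : q ^ (m + 1) * (chi q x₂ * chi q x₁) = 1 := by
      rw [← chi_mul hq, hx, ← chi_t_pow hq (m + 1), ← chi_mul hq, hm, chi_one]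
    rw [smul_smul, ← add_smul, antiCoeff_succ]
    have h4 : q ^ (m + 1) = q ^ s * q ^ (r + 1) := by rw [← pow_add, ← hrs]; congr 1; omega
    rw [h4] at h3
    rw [show chi q x₁ ^ r * antiCoeff q x₂ r + q ^ s *
        (chi q x₁ ^ (r + 1) * (antiCoeff q x₂ r * -(q ^ (r + 1) * chi q x₂))) = 0 by
      linear_combination -(chi q x₁ ^ r * antiCoeff q x₂ r) * h3, zero_smul]

theorem antipode_right_aux [NeZero n] (hq : IsPrimitiveRoot q n) {y : Taft k n} (m : ℕ)
    (y₂ y₁ : Taft k n) (hy : y₂ * y₁ = y) (hm : t k n ^ m * 1 = y) :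
    ∑ x₁ : Taft k n, antipodeMulRight k (fun {x y} => antipode q x y) x₁ y₂ y₁
      (comul hq 1 y x₁⁻¹ x₁ y₂ y₁ (P m 1 y)) = if m = 0 then P 0 y₁⁻¹ y₂ else 0 := by
  have h1 : ∀ x₁ : Taft k n, antipodeMulRight k (fun {x y} => antipode q x y) x₁ y₂ y₁
      (comul hq 1 y x₁⁻¹ x₁ y₂ y₁ (P m 1 y)) =
      qSum q m fun r s => if x₁ = (t k n ^ s)⁻¹ * y₁ then
        (chi q ((t k n ^ s)⁻¹ * y₁) ^ r * antiCoeff q ((t k n ^ s)⁻¹ * y₁) s) •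
          P m y₁⁻¹ y₂ else 0 := by
    intro x₁
    rw [comul_P hq m (inv_mul_cancel x₁) hy, map_qSum]
    refine qSum_congr q fun r s hrs => ?_
    rw [comulTerm, map_smul, antipodeMulRight, TensorProduct.lift.tmul, LinearMap.compl₂_apply,
      antipode_P, map_smul, LinearMap.flip_apply, Linear.comp_apply,
      Linear.leftComp_apply]
    split_ifs with h
    · have h2 : x₁⁻¹ = t k n ^ s * y₁⁻¹ := by
        rw [h, mul_inv_rev, inv_inv, mul_comm]
      rw [h2, P_comp, smul_smul, ← hrs, add_comm r s, h]
    · rw [P_of_ne (m := s) (x := y₁⁻¹), Limits.zero_comp, smul_zero, smul_zero]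
      intro h2
      refine h ?_
      rw [← inv_inj, ← h2, mul_inv_rev, inv_inv, mul_comm]
  rw [Finset.sum_congr rfl fun y₂ _ => h1 y₂]
  simp only [qSum]
  rw [Finset.sum_comm]
  simp only [← Finset.smul_sum, Finset.sum_ite_eq', Finset.mem_univ, if_true]
  change qSum q m (fun r s => (chi q ((t k n ^ s)⁻¹ * y₁) ^ r *
    antiCoeff q ((t k n ^ s)⁻¹ * y₁) s) • P m y₁⁻¹ y₂) = _
  cases m with
  | zero => simp [qSum_zero_left, antiCoeff]
  | succ m =>
    rw [if_neg (Nat.succ_ne_zero m), qSum_succ', qSum_eq_zero]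
    intro r s _
    have h2 : (t k n ^ s)⁻¹ * y₁ = t k n ^ 1 * ((t k n ^ (s + 1))⁻¹ * y₁) := by
      rw [pow_one, pow_succ', mul_inv, mul_assoc, mul_inv_cancel_left]
    have h3 : chi q ((t k n ^ s)⁻¹ * y₁) = q * chi q ((t k n ^ (s + 1))⁻¹ * y₁) := by
      rw [h2, chi_mul hq, chi_t_pow hq, pow_one]
    rw [smul_smul, ← add_smul, add_comm s 1, antiCoeff_add hq, add_comm 1 s, ← h2, h3, antiCoeff,
      Finset.prod_range_one]
    convert zero_smul k _
    ring

end Taft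

open Taft in
/-- The Hopf `k`-category `T_{n,q}`. -/
def taftHopf [NeZero n] (q : k) (hq : IsPrimitiveRoot q n) : HopfStructure k (Taft k n) where
  comul {x y} x₂ x₁ y₂ y₁ _ _ := comul hq x y x₂ x₁ y₂ y₁
  comul_comp f g x₂ x₁ z₂ z₁ hx hz := comul_comp hq f g x₂ x₁ z₂ z₁ hx hz
  comul_id x₂ x₁ hx := comul_id hq x₂ x₁ hx
  comul_id_of_ne x₂ x₁ y₂ y₁ hx hy h := comul_id_of_ne hq x₂ x₁ y₂ y₁ hx hy h
  counit {x y} := counit x y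
  counit_comp := counit_comp
  counit_id := counit_id
  counit_eq_zero := counit_eq_zero
  antipode {x y} := antipode q x y
  antipode_comp := antipode_comp hq
  antipode_id := antipode_id
  coassoc := coassoc hq
  counit_left := counit_left hq
  counit_right := counit_right hq
  antipode_left {x} f x₂ x₁ hx h := by
    have key : ∑ y₂ : Taft k n, antipodeMulLeft k (fun {x y} => antipode q x y) x₂ x₁ y₂ ∘ₗ
        comul hq x 1 x₂ x₁ y₂ y₂⁻¹ = (counit x 1).smulRight (eqToHom h) := by
      refine hom_ext fun m hm => ?_
      simp only [LinearMap.sum_apply, LinearMap.comp_apply, LinearMap.smulRight_apply, counit_P]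
      rw [antipode_left_aux hq m x₂ x₁ hx hm]
      split_ifs with h1 h2 h2
      · rw [← P_eqToHom 0 h, P_zero, Category.id_comp, one_smul]
      · subst h1; simp at hm; simp [hm] at h2
      · exact absurd h2.2.2 h1
      · rw [zero_smul]
    have := LinearMap.congr_fun key f
    rw [LinearMap.sum_apply] at this
    exact this
  antipode_left_of_ne {x} f x₂ x₁ hx h := by
    have key : ∑ y₂ : Taft k n, antipodeMulLeft k (fun {x y} => antipode q x y) x₂ x₁ y₂ ∘ₗ
        comul hq x 1 x₂ x₁ y₂ y₂⁻¹ = 0 := by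
      refine hom_ext fun m hm => ?_
      simp only [LinearMap.sum_apply, LinearMap.comp_apply, LinearMap.zero_apply]
      rw [antipode_left_aux hq m x₂ x₁ hx hm, P_of_ne (by simpa using h), ite_self]
    have := LinearMap.congr_fun key f
    rw [LinearMap.sum_apply] at this
    exact this
  antipode_right {y} f y₂ y₁ hy h := by
    have key : ∑ x₁ : Taft k n, antipodeMulRight k (fun {x y} => antipode q x y) x₁ y₂ y₁ ∘ₗ
        comul hq 1 y x₁⁻¹ x₁ y₂ y₁ = (counit 1 y).smulRight (eqToHom h) := by
      refine hom_ext fun m hm => ?_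
      simp only [LinearMap.sum_apply, LinearMap.comp_apply, LinearMap.smulRight_apply, counit_P]
      rw [antipode_right_aux hq m y₂ y₁ hy hm]
      split_ifs with h1 h2 h2
      · rw [← P_eqToHom 0 h, P_zero, Category.id_comp, one_smul]
      · subst h1; simp at hm; simp [← hm] at h2
      · exact absurd h2.2.2 h1
      · rw [zero_smul]
    have := LinearMap.congr_fun key f
    rw [LinearMap.sum_apply] at this
    exact this
  antipode_right_of_ne {y} f y₂ y₁ hy h := by
    have key : ∑ x₁ : Taft k n, antipodeMulRight k (fun {x y} => antipode q x y) x₁ y₂ y₁ ∘ₗ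
        comul hq 1 y x₁⁻¹ x₁ y₂ y₁ = 0 := by
      refine hom_ext fun m hm => ?_
      simp only [LinearMap.sum_apply, LinearMap.comp_apply, LinearMap.zero_apply]
      rw [antipode_right_aux hq m y₂ y₁ hy hm, P_of_ne (by simpa using h), ite_self]
    have := LinearMap.congr_fun key f
    rw [LinearMap.sum_apply] at this
    exact this


open Taft in
/-- `Δ(a_x) = Σ_{x₂ x₁ = x} id_{x₂} ⊗ a_{x₁} + q^i a_{x₂} ⊗ id_{x₁}`, where `x₁ = t^i`: the
components on which the first and the second summands live, and the other components. -/
theorem taft_comul_arrow [NeZero n] (hn : 2 ≤ n) {q : k} (hq : IsPrimitiveRoot q n)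
    (x x₂ x₁ : Taft k n) (hx : x₂ * x₁ = x) :
    (∀ h, (taftHopf k n q hq).comul x₂ x₁ x₂ (t k n * x₁) hx h (arrow x) = 𝟙 x₂ ⊗ₜ[k] arrow x₁) ∧
    (∀ h, (taftHopf k n q hq).comul x₂ x₁ (t k n * x₂) x₁ hx h (arrow x) =
      chi q x₁ • (arrow x₂ ⊗ₜ[k] 𝟙 x₁)) ∧
    (∀ (y₂ y₁ : Taft k n) (h : y₂ * y₁ = t k n * x), y₂ ≠ x₂ → y₁ ≠ x₁ →
      (taftHopf k n q hq).comul x₂ x₁ y₂ y₁ hx h (arrow x) = 0) := by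
  have ht : ∀ z : Taft k n, t k n * z ≠ z := by
    intro z hz
    have h1 : (1 : ZMod n) = 0 := mul_eq_right.1 hz
    have : Fact (1 < n) := ⟨hn⟩
    exact one_ne_zero h1
  have key : ∀ y₂ y₁ (h : y₂ * y₁ = t k n * x), (taftHopf k n q hq).comul x₂ x₁ y₂ y₁ hx h (arrow x) =
      P 0 x₂ y₂ ⊗ₜ[k] P 1 x₁ y₁ + chi q x₁ • (P 1 x₂ y₂ ⊗ₜ[k] P 0 x₁ y₁) := by
    intro y₂ y₁ h
    have h2 : (taftHopf k n q hq).comul x₂ x₁ y₂ y₁ hx h (arrow x) = _ :=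
      (congrArg (comul hq _ _ x₂ x₁ y₂ y₁) (P_one x).symm).trans (comul_P hq 1 hx h)
    rw [h2, qSum_succ, qSum_zero_left]
    simp [comulTerm]
  refine ⟨fun h => ?_, fun h => ?_, fun y₂ y₁ h h2 h1 => ?_⟩
  · rw [key, P_zero, P_one, P_of_ne (m := 1) (x := x₂) (by rw [pow_one]; exact ht x₂),
      TensorProduct.zero_tmul, smul_zero, add_zero]
  · rw [key, P_zero, P_one, P_of_ne (m := 1) (x := x₁) (by rw [pow_one]; exact ht x₁),
      TensorProduct.tmul_zero, zero_add]
  · rw [key, P_of_ne (m := 0) (x := x₂) (by simpa using h2.symm),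
      P_of_ne (m := 0) (x := x₁) (by simpa using h1.symm), TensorProduct.zero_tmul,
      TensorProduct.tmul_zero, smul_zero, add_zero]

open Taft in
/-- `S(a_x) = - q^(i + 1) a_y`, where `x = t^i` and `y = (t x)⁻¹`, so that `t y = x⁻¹`. -/
theorem taft_antipode_arrow [NeZero n] {q : k} (hq : IsPrimitiveRoot q n) (x : Taft k n) :
    (taftHopf k n q hq).antipode (arrow x) =
      -(q * chi q x) • (arrow (t k n * x)⁻¹ ≫ eqToHom (by rw [mul_inv, mul_inv_cancel_left])) := by
  have h : (taftHopf k n q hq).antipode (arrow x) = _ :=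
    (congrArg (antipode q x (t k n * x)) (P_one x).symm).trans (antipode_P 1 _ _)
  rw [h, ← P_one, P_eqToHom, antiCoeff, Finset.prod_range_one, zero_add, pow_one]

variable {k n}

/-- `c` is the `X`-degree of the walk `(a_{t^(n-1)}, 1) ⋯ (a_t, 1) (a_1, 1)` around the crown. -/
def Grading.IsTurnDegree (X : Grading.{u, u, w, 0} k (Taft k n)) (c : X.Γ) : Prop :=
  ∃ d : ℕ → X.Γ, (∀ i, Taft.arrow (Taft.t k n ^ i) ∈ X.comp (d i) (Taft.t k n ^ i)
    (Taft.t k n * Taft.t k n ^ i)) ∧ c = ((List.range n).map d).reverse.prod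

end Taft

/-! ### The inverse limit -/

/-- The inverse limit of the groups `ℤ/mℤ` for `m` coprime to `n`, with respect to the canonical
projections `ℤ/mℤ → ℤ/m'ℤ` for `m' ∣ m`. -/
def coprimeLim (n : ℕ) : AddSubgroup (∀ m : {m : ℕ // m.Coprime n}, ZMod m) where
  carrier := {x | ∀ (m m' : {m : ℕ // m.Coprime n}) (h : m'.1 ∣ m.1),
    ZMod.castHom h (ZMod m') (x m) = x m'}
  zero_mem' m m' h := map_zero _
  add_mem' {x y} hx hy m m' h := by
    rw [Pi.add_apply, Pi.add_apply, map_add, hx m m' h, hy m m' h]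
  neg_mem' {x} hx m m' h := by
    rw [Pi.neg_apply, Pi.neg_apply, map_neg, hx m m' h]

/-- The map `ℤ → lim ℤ/mℤ` induced by the canonical projections. -/
def toCoprimeLim (n : ℕ) : ℤ →+ coprimeLim n where
  toFun z := ⟨fun m => (z : ZMod m), fun _ _ _ => map_intCast _ z⟩
  map_zero' := Subtype.ext (funext fun _ => Int.cast_zero)
  map_add' a b := Subtype.ext (funext fun _ => Int.cast_add a b)

end HopfCat

end

noncomputable section

namespace HopfCat

/-! ### Gradings of the Taft categories -/

namespace Taft

variable {k : Type u} [Field k] {n : ℕ}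

/-! Between two objects `x`, `y` of the Taft category there is exactly one path of length `< n`, and
all longer ones vanish, so every space of morphisms is a line (`Taft.exists_smul_P`,
`Taft.P_ne_zero`). In any grading each such line is therefore homogeneous of a single degree
(`Grading.exists_deg`), every morphism is homogeneous, and a linear automorphism that fixes the
objects cannot change the combinatorics of walks.

The degree of a closed walk at `1` is a power `c_X ^ z` of the degree of the turn, and `z` depends
neither on the grading nor on the automorphism (`LinAut.mapWalk_deg_loop`). Two consequences follow.
A grading is connected exactly when `c_X` generates `Γ_X` (`Grading.isConnected_iff`), and `μ` is a
morphism exactly when `μ c_X = c_Y` (`ConnectedGrading.isMorphism_iff`). Connected gradings thus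
behave like cyclic groups with a chosen generator. Since the degrees of the arrows can be prescribed
freely, a grading by `ℤ` with `c = 1` exists; it maps to all the others, and a compatible family is
determined by its value there. This is the isomorphism `L`.

For a Hopf grading, the component `id ⊗ a` of `Δ(a)` forces all arrows to have one common degree `g`
(`Grading.IsHopf.arrowDeg_eq`). Then `c = g ^ n` generates a finite cyclic group that contains `g`,
which forces the order to be coprime to `n`. Conversely, for `m` coprime to `n`, the constant degree
`n⁻¹` in `ℤ/mℤ` gives a connected Hopf grading with `c = 1`. These gradings are initial among those
with `c ^ m = 1`, whence the limit and the isomorphism `R`.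

The square commutes because both ways around it read off the exponent of the turn. The bottom arrow
is injective because `|z| n + 1` is coprime to `n` and larger than `|z|`. -/

theorem t_pow_eq_iff {i j : ℕ} : t k n ^ i = t k n ^ j ↔ i ≡ j [MOD n] := by
  rw [← ZMod.natCast_eq_natCast_iff]
  have h : ∀ i : ℕ, t k n ^ i = Multiplicative.ofAdd (i : ZMod n) := by
    intro i
    change Multiplicative.ofAdd (i • (1 : ZMod n)) = _
    rw [nsmul_one]
  rw [h, h]
  exact Iff.rfl

theorem exists_lt_pow_mul_eq [NeZero n] (x y : Taft k n) : ∃ m < n, t k n ^ m * x = y := by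
  refine ⟨(Multiplicative.toAdd (α := ZMod n) (y * x⁻¹)).val, ZMod.val_lt _, ?_⟩
  have h : t k n ^ (Multiplicative.toAdd (α := ZMod n) (y * x⁻¹)).val = y * x⁻¹ := by
    change Multiplicative.ofAdd
      ((Multiplicative.toAdd (α := ZMod n) (y * x⁻¹)).val • (1 : ZMod n)) = _
    rw [nsmul_one, ZMod.natCast_zmod_val]
    rfl
  rw [h, inv_mul_cancel_right]

theorem exists_eq_t_pow [NeZero n] (x : Taft k n) : ∃ i, x = t k n ^ i := by
  obtain ⟨m, -, hm⟩ := exists_lt_pow_mul_eq 1 x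
  exact ⟨m, by rw [← hm, mul_one]⟩

theorem eq_of_lt_of_pow_mul_eq {x y : Taft k n} {m m' : ℕ} (hm : m < n) (hm' : m' < n)
    (h : t k n ^ m * x = y) (h' : t k n ^ m' * x = y) : m = m' :=
  Nat.ModEq.eq_of_lt_of_lt (t_pow_eq_iff.1 (mul_right_cancel (h.trans h'.symm))) hm hm'

/-- The functional takes the value `1` on lengths `< n` and kills lengths `≥ n`, so it descends to
the quotient. It witnesses that short paths survive there, and it later detects nonzero pure
tensors. -/
theorem exists_dual {x y : Taft k n} {m : ℕ} (hm : m < n) (h : t k n ^ m * x = y) :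
    ∃ φ : (x ⟶ y) →ₗ[k] k, φ (P m x y) = 1 :=
  ⟨desc x y (fun i => if i < n then 1 else 0) fun i hi => if_neg hi.not_gt,
    by rw [desc_P _ _ h, if_pos hm]⟩

theorem P_ne_zero {x y : Taft k n} {m : ℕ} (hm : m < n) (h : t k n ^ m * x = y) :
    P m x y ≠ 0 := by
  obtain ⟨φ, hφ⟩ := exists_dual hm h
  intro h0
  rw [h0, map_zero] at hφ
  exact zero_ne_one hφ

/-- Lengths of paths from `x` to `y` are congruent modulo `n`, so only one of them is `< n`; all the
other paths are zero. Hence the classes of paths span a line. -/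
theorem exists_smul_P {x y : Taft k n} {m : ℕ} (hm : m < n) (h : t k n ^ m * x = y) (f : x ⟶ y) :
    ∃ c : k, f = c • P m x y := by
  have key : (Submodule.span k {P m x y}).mkQ = 0 := by
    refine hom_ext fun m' h' => ?_
    rcases lt_or_ge m' n with hlt | hge
    · obtain rfl := eq_of_lt_of_pow_mul_eq hm hlt h h'
      rw [LinearMap.zero_apply, Submodule.mkQ_apply, Submodule.Quotient.mk_eq_zero]
      exact Submodule.mem_span_singleton_self _
    · rw [P_of_le hge, map_zero, map_zero]
  have h1 := LinearMap.congr_fun key f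
  rw [LinearMap.zero_apply, Submodule.mkQ_apply, Submodule.Quotient.mk_eq_zero,
    Submodule.mem_span_singleton] at h1
  obtain ⟨c, hc⟩ := h1
  exact ⟨c, hc.symm⟩

theorem arrow_ne_zero (hn : 2 ≤ n) (x : Taft k n) : arrow x ≠ 0 := by
  rw [← P_one]
  exact P_ne_zero hn (by rw [pow_one])

theorem id_ne_zero [NeZero n] (x : Taft k n) : 𝟙 x ≠ 0 := by
  rw [← P_zero]
  exact P_ne_zero (NeZero.pos n) (by rw [pow_zero, one_mul])

end Taft

/-! ### Degrees of morphisms and of the turn in an arbitrary grading -/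

namespace Grading

variable {k : Type u} [Field k]

theorem deg_unique {B : Type o} [Category.{v} B] [Preadditive B] [Linear k B]
    (X : Grading.{u, v, w, o} k B) {x y : B} {f : x ⟶ y} (hf : f ≠ 0) {s s' : X.Γ}
    (h : f ∈ X.comp s x y) (h' : f ∈ X.comp s' x y) : s = s' := by
  classical
  by_contra hne
  have hd := (X.isInternal x y).submodule_iSupIndep.pairwiseDisjoint hne
  exact hf (Submodule.disjoint_def.1 hd f h h')

/-- An identity is idempotent, so its degree satisfies `s = s * s`. -/
theorem id_mem {B : Type o} [Category.{v} B] [Preadditive B] [Linear k B]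
    (X : Grading.{u, v, w, o} k B) {x : B} (h0 : 𝟙 x ≠ 0) {s : X.Γ}
    (h : 𝟙 x ∈ X.comp s x x) : s = 1 := by
  have h2 := X.comp_mem s s _ _ h h
  rw [Category.id_comp] at h2
  exact left_eq_mul.1 (X.deg_unique h0 h h2)

variable {n : ℕ} [NeZero n] (X : Grading.{u, u, w, 0} k (Taft k n))

/-- A line has no subspaces besides `⊥` and itself, and the homogeneous components span it, so one
of them is everything. -/
theorem exists_deg (x y : Taft k n) : ∃ s, ∀ f : x ⟶ y, f ∈ X.comp s x y := by
  classical
  obtain ⟨m, hm, h⟩ := Taft.exists_lt_pow_mul_eq x y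
  by_contra! hne
  have hbot : ∀ s, X.comp s x y = ⊥ := by
    intro s
    rw [Submodule.eq_bot_iff]
    intro f hf
    by_contra h0
    obtain ⟨g, hg⟩ := hne s
    obtain ⟨c, rfl⟩ := Taft.exists_smul_P hm h f
    obtain ⟨d, rfl⟩ := Taft.exists_smul_P hm h g
    -- A nonzero multiple of the generator lies in the component, hence so does the generator and
    -- then every morphism.
    have hc : c ≠ 0 := by rintro rfl; exact h0 (zero_smul _ _)
    have hP := (Submodule.smul_mem_iff _ hc).1 hf
    exact hg (Submodule.smul_mem _ _ hP)
  have htop := (X.isInternal x y).submodule_iSup_eq_top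
  simp only [hbot, iSup_bot] at htop
  have hP : Taft.P m x y ∈ (⊥ : Submodule k (x ⟶ y)) := htop ▸ Submodule.mem_top
  exact Taft.P_ne_zero hm h ((Submodule.mem_bot k).1 hP)

/-- The degree of the morphisms from `x` to `y`, which are all homogeneous of the same degree. -/
def homDeg (x y : Taft k n) : X.Γ := (X.exists_deg x y).choose

theorem mem_homDeg {x y : Taft k n} (f : x ⟶ y) : f ∈ X.comp (X.homDeg x y) x y :=
  (X.exists_deg x y).choose_spec f

theorem eq_homDeg {x y : Taft k n} {f : x ⟶ y} (hf : f ≠ 0) {s : X.Γ}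
    (h : f ∈ X.comp s x y) : s = X.homDeg x y :=
  X.deg_unique hf h (X.mem_homDeg f)

theorem homDeg_self (x : Taft k n) : X.homDeg x x = 1 :=
  X.id_mem (Taft.id_ne_zero x) (X.mem_homDeg _)

/-- The degree of the generating morphism starting at `x`. -/
def arrowDeg (x : Taft k n) : X.Γ := X.homDeg x (Taft.t k n * x)

theorem arrow_mem (x : Taft k n) :
    Taft.arrow x ∈ X.comp (X.arrowDeg x) x (Taft.t k n * x) :=
  X.mem_homDeg _

/-- The degree of the formal path of length `i` starting at the object `1`. -/
def pathDeg : ℕ → X.Γ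
  | 0 => 1
  | i + 1 => X.arrowDeg (Taft.t k n ^ i) * pathDeg i

/-- The degree of the turn around the crown starting at the object `1`. -/
def turn : X.Γ := X.pathDeg n

theorem isTurnDegree_turn : X.IsTurnDegree X.turn := by
  refine ⟨fun i => X.arrowDeg (Taft.t k n ^ i), fun i => X.arrow_mem _, ?_⟩
  have h : ∀ i, X.pathDeg i =
      ((List.range i).map fun i => X.arrowDeg (Taft.t k n ^ i)).reverse.prod := by
    intro i
    induction i with
    | zero => rfl
    | succ i ih => rw [List.range_succ, List.map_append, List.reverse_append, pathDeg, ih]; rfl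
  exact h n

/-- Degrees of arrows are periodic because `t ^ n = 1`. The turn is a right factor, since the path
makes its full turn at `1` first and later arrows multiply on the left; `Γ` need not be commutative
here. -/
theorem pathDeg_add (i : ℕ) : X.pathDeg (i + n) = X.pathDeg i * X.turn := by
  induction i with
  | zero => rw [Nat.zero_add, pathDeg, one_mul, turn]
  | succ i ih =>
    rw [Nat.add_right_comm, pathDeg, ih, pathDeg, pow_add, Taft.t_pow_self, mul_one, mul_assoc]

theorem pathDeg_add_mul (i a : ℕ) : X.pathDeg (i + n * a) = X.pathDeg i * X.turn ^ a := by
  induction a with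
  | zero => simp
  | succ a ih => rw [Nat.mul_succ, ← add_assoc, pathDeg_add, ih, pow_succ, mul_assoc]

/-- The exponent is the signed number of turns `(i - j) / n`. It is chosen before the grading, so
that the same `z` serves a walk and its image in another grading. -/
theorem exists_pathDeg_eq {i j : ℕ} (h : Taft.t k n ^ i = Taft.t k n ^ j) :
    ∃ z : ℤ, ∀ X : Grading.{u, u, w, 0} k (Taft k n),
      X.pathDeg i = X.pathDeg j * X.turn ^ z := by
  have h1 := Taft.t_pow_eq_iff.1 h
  rcases le_total j i with hij | hij
  · obtain ⟨a, ha⟩ := (Nat.modEq_iff_dvd' hij).1 h1.symm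
    refine ⟨a, fun X => ?_⟩
    rw [zpow_natCast, ← pathDeg_add_mul, ← ha]
    congr 1; omega
  · obtain ⟨a, ha⟩ := (Nat.modEq_iff_dvd' hij).1 h1
    refine ⟨-a, fun X => ?_⟩
    rw [zpow_neg, zpow_natCast, eq_mul_inv_iff_mul_eq, ← pathDeg_add_mul, ← ha]
    congr 1; omega

/-- Nothing is assumed about `l` and `y`: where the path does not exist or is too long, `P` is `0`
and lies in every component. -/
theorem P_mem (i l : ℕ) {x y : Taft k n} (hx : x = Taft.t k n ^ i) :
    Taft.P l x y ∈ X.comp (X.pathDeg (i + l) * (X.pathDeg i)⁻¹) x y := by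
  subst hx
  by_cases hy : Taft.t k n ^ l * Taft.t k n ^ i = y
  swap
  · rw [Taft.P_of_ne hy]; exact zero_mem _
  subst hy
  induction l with
  | zero =>
    have h := X.mem_homDeg (Taft.P 0 (Taft.t k n ^ i) (Taft.t k n ^ 0 * Taft.t k n ^ i))
    rw [pow_zero, one_mul] at h ⊢
    rwa [homDeg_self, ← mul_inv_cancel (X.pathDeg i)] at h
  | succ l ih =>
    have h := X.mem_homDeg (Taft.P 1 (Taft.t k n ^ l * Taft.t k n ^ i)
      (Taft.t k n ^ (l + 1) * Taft.t k n ^ i))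
    have h2 := X.comp_mem _ _ _ _ ih h
    rw [Taft.P_comp] at h2
    have h3 : X.homDeg (Taft.t k n ^ l * Taft.t k n ^ i) (Taft.t k n ^ (l + 1) * Taft.t k n ^ i) =
        X.arrowDeg (Taft.t k n ^ (i + l)) := by
      rw [arrowDeg, pow_succ', mul_assoc, ← pow_add, add_comm l i]
    rw [h3, ← mul_assoc] at h2
    exact h2

/-- The degree of a line of morphisms is a quotient of degrees of paths from `1`. Again `l` does not
depend on the grading. -/
theorem exists_homDeg_eq {x : Taft k n} {i : ℕ} (hx : x = Taft.t k n ^ i) (y : Taft k n) :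
    ∃ l, y = Taft.t k n ^ (i + l) ∧ ∀ X : Grading.{u, u, w, 0} k (Taft k n),
      X.homDeg x y = X.pathDeg (i + l) * (X.pathDeg i)⁻¹ := by
  obtain ⟨l, hl, h⟩ := Taft.exists_lt_pow_mul_eq x y
  refine ⟨l, by rw [← h, hx, ← pow_add, add_comm], fun X => ?_⟩
  exact (X.eq_homDeg (Taft.P_ne_zero hl h) (X.P_mem i l hx)).symm

variable {X}

theorem Step.deg_fwd {x y : Taft k n} (f : x ⟶ y) (hf : f ≠ 0) (h : X.IsHomogeneous f) :
    (Step.fwd f hf h : X.Step x y).deg = X.homDeg x y :=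
  X.eq_homDeg hf h.choose_spec

theorem Step.deg_bwd {x y : Taft k n} (f : y ⟶ x) (hf : f ≠ 0) (h : X.IsHomogeneous f) :
    (Step.bwd f hf h : X.Step x y).deg = (X.homDeg y x)⁻¹ :=
  congrArg _ (X.eq_homDeg hf h.choose_spec)

theorem isHomogeneous {x y : Taft k n} (f : x ⟶ y) : X.IsHomogeneous f := ⟨_, X.mem_homDeg f⟩

end Grading

/-! ### Homogeneous walks and their images: morphisms of gradings are governed by the turn -/

namespace LinAut

variable {k : Type u} [Field k] {n : ℕ} [NeZero n] {X Y : Grading.{u, u, w, 0} k (Taft k n)}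
  {J : LinAut k (Taft k n)} (hJ : J.IsHomogeneous X Y)

/-- A pair of degrees taken by a homogeneous walk and by its image. -/
def WalkDeg (x y : Taft k n) (s : X.Γ) (s' : Y.Γ) : Prop :=
  ∃ p : X.Walk x y, p.deg = s ∧ (J.mapWalk hJ p).deg = s'

variable {hJ}

theorem walkDeg_hom {x y : Taft k n} {f : x ⟶ y} (hf : f ≠ 0) :
    WalkDeg hJ x y (X.homDeg x y) (Y.homDeg x y) :=
  ⟨.single (.fwd f hf (Grading.isHomogeneous f)), Grading.Step.deg_fwd _ _ _,
    Grading.Step.deg_fwd _ _ _⟩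

/-- The image of a step is a nonzero morphism between the same objects, and its degree is that of
the whole line; so `J` has no influence on degrees. -/
theorem step_deg {x y : Taft k n} (a : X.Step x y) :
    (a.deg = X.homDeg x y ∧ (J.mapStep hJ a).deg = Y.homDeg x y) ∨
      (a.deg = (X.homDeg y x)⁻¹ ∧ (J.mapStep hJ a).deg = (Y.homDeg y x)⁻¹) := by
  cases a with
  | fwd f hf h => exact .inl ⟨Grading.Step.deg_fwd _ _ _, Grading.Step.deg_fwd _ _ _⟩
  | bwd f hf h => exact .inr ⟨Grading.Step.deg_bwd _ _ _, Grading.Step.deg_bwd _ _ _⟩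

omit [NeZero n] in
theorem mapWalk_cons_deg {x y z : Taft k n} (p : X.Walk x y) (a : X.Step y z) :
    (J.mapWalk hJ (.cons p a)).deg = (J.mapStep hJ a).deg * (J.mapWalk hJ p).deg := rfl

omit [NeZero n] in
theorem WalkDeg.trans {x y z : Taft k n} {s t : X.Γ} {s' t' : Y.Γ} (h : WalkDeg hJ x y s s')
    (h' : WalkDeg hJ y z t t') : WalkDeg hJ x z (t * s) (t' * s') := by
  obtain ⟨p, rfl, rfl⟩ := h
  obtain ⟨p', rfl, rfl⟩ := h'
  induction p' with
  | single a => exact ⟨.cons p a, rfl, rfl⟩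
  | cons p' a ih =>
    obtain ⟨r, hr, hr'⟩ := ih
    exact ⟨.cons r a, by rw [Grading.Walk.deg, hr, Grading.Walk.deg, mul_assoc],
      by rw [mapWalk_cons_deg, hr', mapWalk_cons_deg, mul_assoc]⟩

omit [NeZero n] in
theorem walkDeg_step_symm {x y : Taft k n} (a : X.Step x y) :
    WalkDeg hJ y x a.deg⁻¹ (J.mapStep hJ a).deg⁻¹ := by
  cases a with
  | fwd f hf h => exact ⟨.single (.bwd f hf h), rfl, rfl⟩
  | bwd f hf h => exact ⟨.single (.fwd f hf h), (inv_inv _).symm, (inv_inv _).symm⟩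

omit [NeZero n] in
theorem WalkDeg.symm {x y : Taft k n} {s : X.Γ} {s' : Y.Γ} (h : WalkDeg hJ x y s s') :
    WalkDeg hJ y x s⁻¹ s'⁻¹ := by
  obtain ⟨p, rfl, rfl⟩ := h
  induction p with
  | single a => exact walkDeg_step_symm a
  | cons p a ih =>
    have h := (walkDeg_step_symm (hJ := hJ) a).trans ih
    rw [← mul_inv_rev, ← mul_inv_rev] at h
    exact h

theorem walkDeg_path (hn : 2 ≤ n) (i : ℕ) :
    WalkDeg hJ 1 (Taft.t k n ^ i) (X.pathDeg i) (Y.pathDeg i) := by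
  induction i with
  | zero =>
    have h := walkDeg_hom (hJ := hJ) (Taft.id_ne_zero (1 : Taft k n))
    rw [Grading.homDeg_self, Grading.homDeg_self] at h
    rw [pow_zero]
    exact h
  | succ i ih =>
    rw [pow_succ']
    exact ih.trans (walkDeg_hom (Taft.arrow_ne_zero hn _))

theorem walkDeg_turn (hn : 2 ≤ n) : WalkDeg hJ 1 1 X.turn Y.turn := by
  have h := walkDeg_path (hJ := hJ) hn n
  rwa [Taft.t_pow_self] at h

theorem walkDeg_turn_zpow (hn : 2 ≤ n) (z : ℤ) :
    WalkDeg hJ 1 1 (X.turn ^ z) (Y.turn ^ z) := by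
  have h : ∀ a : ℕ, WalkDeg hJ 1 1 (X.turn ^ a) (Y.turn ^ a) := by
    intro a
    induction a with
    | zero =>
      have h := walkDeg_path (hJ := hJ) hn 0
      rw [pow_zero] at h
      rw [pow_zero, pow_zero]
      exact h
    | succ a ih => rw [pow_succ', pow_succ']; exact ih.trans (walkDeg_turn hn)
  obtain ⟨a, rfl | rfl⟩ := z.eq_nat_or_neg
  · simpa using h a
  · simpa using (h a).symm

/-- Normal form of a walk from `1`: some turns, then a direct path to the end point. Both gradings
are treated at once in order to obtain the same `i` and `z`. -/
theorem mapWalk_deg {y : Taft k n} (p : X.Walk 1 y) :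
    ∃ (i : ℕ) (z : ℤ), y = Taft.t k n ^ i ∧ p.deg = X.pathDeg i * X.turn ^ z ∧
      (J.mapWalk hJ p).deg = Y.pathDeg i * Y.turn ^ z := by
  have step : ∀ {x y : Taft k n} (a : X.Step x y) (i : ℕ), x = Taft.t k n ^ i →
      ∃ (j : ℕ) (z : ℤ), y = Taft.t k n ^ j ∧ a.deg * X.pathDeg i = X.pathDeg j * X.turn ^ z ∧
        (J.mapStep hJ a).deg * Y.pathDeg i = Y.pathDeg j * Y.turn ^ z := by
    intro x y a i hx
    rcases step_deg (hJ := hJ) a with ⟨h, h'⟩ | ⟨h, h'⟩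
    · obtain ⟨l, hl, hd⟩ := Grading.exists_homDeg_eq hx y
      exact ⟨i + l, 0, hl, by rw [h, hd]; simp, by rw [h', hd]; simp⟩
    -- A backward step runs along a path of length `l` from `y = t ^ j` to `x`. Since `i` and `j +
    -- l` name the same object, they differ by `z` turns.
    · obtain ⟨j, hj⟩ := Taft.exists_eq_t_pow y
      obtain ⟨l, hl, hd⟩ := Grading.exists_homDeg_eq hj x
      obtain ⟨z, hz⟩ := Grading.exists_pathDeg_eq (hx.symm.trans hl)
      exact ⟨j, z, hj, by rw [h, hd, hz X]; group, by rw [h', hd, hz Y]; group⟩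
  -- The source is a variable with an equation, so that the indices of the walk are free for the
  -- induction.
  have key : ∀ {x y : Taft k n} (p : X.Walk x y), x = 1 →
      ∃ (i : ℕ) (z : ℤ), y = Taft.t k n ^ i ∧ p.deg = X.pathDeg i * X.turn ^ z ∧
        (J.mapWalk hJ p).deg = Y.pathDeg i * Y.turn ^ z := by
    intro x y p hx
    induction p with
    | single a =>
      obtain ⟨i, z, hi, h, h'⟩ := step a 0 (by rw [hx, pow_zero])
      rw [Grading.pathDeg, mul_one] at h h'
      exact ⟨i, z, hi, h, h'⟩
    | cons p a ih =>
      obtain ⟨i, z, hi, h, h'⟩ := ih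
      obtain ⟨j, z', hj, g, g'⟩ := step a i hi
      refine ⟨j, z' + z, hj, ?_, ?_⟩
      · rw [Grading.Walk.deg, h, ← mul_assoc, g, zpow_add, mul_assoc]
      · rw [mapWalk_cons_deg, h', ← mul_assoc, g', zpow_add, mul_assoc]
  exact key p rfl

theorem mapWalk_deg_loop (p : X.Walk 1 1) :
    ∃ z : ℤ, p.deg = X.turn ^ z ∧ (J.mapWalk hJ p).deg = Y.turn ^ z := by
  obtain ⟨i, z, hi, h, h'⟩ := mapWalk_deg (hJ := hJ) p
  obtain ⟨z', hz⟩ := Grading.exists_pathDeg_eq (hi.symm.trans (pow_zero (Taft.t k n)).symm)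
  refine ⟨z' + z, ?_, ?_⟩
  · rw [h, hz X, Grading.pathDeg, one_mul, zpow_add]
  · rw [h', hz Y, Grading.pathDeg, one_mul, zpow_add]

/-- The square is tested on the walk around the crown. The bound `2 ≤ n` makes the arrows nonzero,
so that this walk exists. -/
theorem Realizes.map_turn (hn : 2 ≤ n) {μ : X.Γ →* Y.Γ} (h : J.Realizes 1 μ) :
    μ X.turn = Y.turn := by
  obtain ⟨hJ, h⟩ := h
  obtain ⟨p, hp, hp'⟩ := walkDeg_turn (hJ := hJ) hn
  rw [← hp, h, hp']

/-- Every loop and its image have degrees equal to the same power of the respective turns. Here `J`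
is arbitrary, so the identity suffices to realize a morphism. -/
theorem realizes_of_map_turn {μ : X.Γ →* Y.Γ} (h : μ X.turn = Y.turn) : J.Realizes 1 μ := by
  have hJ : J.IsHomogeneous X Y := fun _ _ => Grading.isHomogeneous _
  refine ⟨hJ, fun p => ?_⟩
  obtain ⟨z, hz, hz'⟩ := mapWalk_deg_loop (hJ := hJ) p
  rw [hz, hz', map_zpow, h]

/-- The identity endofunctor. -/
def refl (k : Type u) [Field k] (B : Type o) [Category.{v} B] [Preadditive B] [Linear k B] :
    LinAut k B where
  map x y := LinearEquiv.refl k (x ⟶ y)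
  map_id _ := rfl
  map_comp _ _ := rfl

theorem refl_isHopf {k : Type u} [Field k] {G : Type o} [Group G] [Fintype G]
    [Category.{v} G] [Preadditive G] [Linear k G] (H : HopfStructure k G) :
    (refl k G).IsHopf H where
  comul _ _ _ _ _ _ _ := (LinearMap.congr_fun TensorProduct.map_id _).symm
  counit _ := rfl
  antipode _ := rfl

end LinAut

/-- Degrees of loops at `1` are exactly the powers of the turn, and any two objects are joined to
`1` by paths, which reduces all pairs of objects to loops at `1`. -/
theorem Grading.isConnected_iff {k : Type u} [Field k] {n : ℕ} [NeZero n] (hn : 2 ≤ n)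
    (X : Grading.{u, u, w, 0} k (Taft k n)) :
    X.IsConnected ↔ ∀ s, s ∈ Subgroup.zpowers X.turn := by
  have hJ : (LinAut.refl k (Taft k n)).IsHomogeneous X X := fun _ h => h
  constructor
  · intro h s
    obtain ⟨p, rfl⟩ := h 1 1 s
    obtain ⟨z, hz, -⟩ := LinAut.mapWalk_deg_loop (hJ := hJ) p
    exact ⟨z, hz.symm⟩
  · intro h x y g
    obtain ⟨i, rfl⟩ := Taft.exists_eq_t_pow x
    obtain ⟨j, rfl⟩ := Taft.exists_eq_t_pow y
    -- The walk goes back from `t ^ i` to `1`, turns `z` times, then goes forward to `t ^ j`; this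
    -- element is what the turns must contribute for the total degree to be `g`.
    obtain ⟨z, hz⟩ := h ((X.pathDeg j)⁻¹ * g * X.pathDeg i)
    have h1 := ((LinAut.walkDeg_path (hJ := hJ) hn i).symm.trans
      (LinAut.walkDeg_turn_zpow hn z)).trans (LinAut.walkDeg_path hn j)
    obtain ⟨p, hp, -⟩ := h1
    refine ⟨p, hp.trans ?_⟩
    dsimp only at hz
    rw [hz]
    group

/-! ### Gradings given by weights of the generating morphisms -/

section Weights

variable {k : Type u} [Field k] {n : ℕ} {Γ : Type w} [Group Γ]

/-- The degree of the formal path of length `m` starting at `x`, for given degrees of the generating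
morphisms. -/
def Taft.weight (d : Taft k n → Γ) (x : Taft k n) : ℕ → Γ
  | 0 => 1
  | m + 1 => d (Taft.t k n ^ m * x) * Taft.weight d x m

theorem Taft.weight_add (d : Taft k n → Γ) (x : Taft k n) (a b : ℕ) :
    Taft.weight d x (a + b) = Taft.weight d (Taft.t k n ^ a * x) b * Taft.weight d x a := by
  induction b with
  | zero => rw [add_zero, weight, one_mul]
  | succ b ih => rw [← add_assoc, weight, ih, weight, pow_add, mul_comm (_ ^ a), mul_assoc, mul_assoc]

theorem Taft.weight_const (g : Γ) (x : Taft k n) (m : ℕ) :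
    Taft.weight (fun _ => g) x m = g ^ m := by
  induction m with
  | zero => rw [weight, pow_zero]
  | succ m ih => rw [weight, ih, pow_succ']

/-- The morphisms of degree `s`. -/
def Taft.weightSpace (d : Taft k n → Γ) (s : Γ) (x y : Taft k n) : Submodule k (x ⟶ y) :=
  Submodule.span k {f | ∃ m, Taft.weight d x m = s ∧ f = Taft.P m x y}

theorem Taft.P_mem_weightSpace (d : Taft k n → Γ) (m : ℕ) (x y : Taft k n) :
    Taft.P m x y ∈ Taft.weightSpace d (Taft.weight d x m) x y :=
  Submodule.subset_span ⟨m, rfl, rfl⟩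

theorem Taft.comp_mem_weightSpace (d : Taft k n → Γ) {x y z : Taft k n} (s t : Γ) (f : x ⟶ y)
    (g : y ⟶ z) (hf : f ∈ Taft.weightSpace d s x y) (hg : g ∈ Taft.weightSpace d t y z) :
    f ≫ g ∈ Taft.weightSpace d (t * s) x z := by
  induction hf using Submodule.span_induction with
  | mem f hf =>
    obtain ⟨a, rfl, rfl⟩ := hf
    induction hg using Submodule.span_induction with
    | mem g hg =>
      obtain ⟨b, rfl, rfl⟩ := hg
      by_cases h : Taft.t k n ^ a * x = y
      · subst h
        rw [P_comp, ← weight_add]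
        exact P_mem_weightSpace d _ _ _
      · rw [P_of_ne h, Limits.zero_comp]
        exact zero_mem _
    | zero => rw [Limits.comp_zero]; exact zero_mem _
    | add g g' _ _ h h' => rw [Preadditive.comp_add]; exact add_mem h h'
    | smul c g _ h => rw [Linear.comp_smul]; exact Submodule.smul_mem _ c h
  | zero => rw [Limits.zero_comp]; exact zero_mem _
  | add f f' _ _ h h' => rw [Preadditive.add_comp]; exact add_mem h h'
  | smul c f _ h => rw [Linear.smul_comp]; exact Submodule.smul_mem _ c h

theorem Taft.weightSpace_eq_top (d : Taft k n → Γ) {x y : Taft k n} {m : ℕ} (hm : m < n)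
    (h : Taft.t k n ^ m * x = y) : Taft.weightSpace d (Taft.weight d x m) x y = ⊤ := by
  rw [eq_top_iff]
  intro f _
  obtain ⟨c, rfl⟩ := exists_smul_P hm h f
  exact Submodule.smul_mem _ c (P_mem_weightSpace d m x y)

/-- The weight of a formal path of length `≥ n` may well be `s`, but its class is zero, as is `P`
when there is no path of that length. Hence the generators of the wrong weight all vanish. -/
theorem Taft.weightSpace_eq_bot (d : Taft k n → Γ) {x y : Taft k n} {m : ℕ} (hm : m < n)
    (h : Taft.t k n ^ m * x = y) {s : Γ} (hs : s ≠ Taft.weight d x m) :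
    Taft.weightSpace d s x y = ⊥ := by
  rw [weightSpace, Submodule.span_eq_bot]
  rintro f ⟨m', rfl, rfl⟩
  by_contra h0
  have h1 : Taft.t k n ^ m' * x = y := by
    by_contra h1
    exact h0 (P_of_ne h1)
  have h2 : m' < n := by
    by_contra h2
    exact h0 (P_of_le (not_lt.1 h2) x y)
  exact hs (by rw [eq_of_lt_of_pow_mul_eq hm h2 h h1])

variable [NeZero n]

/-- The grading for which the generating morphism starting at `x` has degree `d x`. -/
def Grading.ofWeight (d : Taft k n → Γ) : Grading.{u, u, w, 0} k (Taft k n) where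
  Γ := Γ
  comp s x y := Taft.weightSpace d s x y
  isInternal x y := by
    classical
    obtain ⟨m, hm, h⟩ := Taft.exists_lt_pow_mul_eq x y
    refine DirectSum.isInternal_submodule_of_iSupIndep_of_iSup_eq_top (fun s => ?_) ?_
    -- Only one component is nonzero, so one side of each independence condition is `⊥`.
    · by_cases hs : s = Taft.weight d x m
      · have h0 : ⨆ j, ⨆ (_ : j ≠ s), Taft.weightSpace d j x y = ⊥ := by
          rw [iSup₂_eq_bot]
          intro j hj
          exact Taft.weightSpace_eq_bot d hm h (hs ▸ hj)
        rw [h0]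
        exact disjoint_bot_right
      · rw [Taft.weightSpace_eq_bot d hm h hs]
        exact disjoint_bot_left
    · exact eq_top_iff.2 ((Taft.weightSpace_eq_top d hm h).symm.le.trans
        (le_iSup (fun s => Taft.weightSpace d s x y) _))
  comp_mem s t f g := Taft.comp_mem_weightSpace d s t f g

theorem Grading.arrowDeg_ofWeight (hn : 2 ≤ n) (d : Taft k n → Γ) (x : Taft k n) :
    (Grading.ofWeight d).arrowDeg x = d x := by
  refine ((Grading.ofWeight d).eq_homDeg (Taft.arrow_ne_zero hn x) ?_).symm
  have h := Taft.P_mem_weightSpace d 1 x (Taft.t k n * x)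
  rw [Taft.P_one, Taft.weight, Taft.weight, mul_one, pow_zero, one_mul] at h
  exact h

theorem Grading.pathDeg_eq_pow (X : Grading.{u, u, w, 0} k (Taft k n)) {g : X.Γ}
    (h : ∀ x, X.arrowDeg x = g) (i : ℕ) : X.pathDeg i = g ^ i := by
  induction i with
  | zero => rw [pathDeg, pow_zero]
  | succ i ih => rw [pathDeg, ih, h, pow_succ']

theorem Grading.turn_ofWeight_const (hn : 2 ≤ n) (g : Γ) :
    (Grading.ofWeight (k := k) (n := n) fun _ => g).turn = g ^ n :=
  Grading.pathDeg_eq_pow _ (fun _ => Grading.arrowDeg_ofWeight hn _ _) n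

/-- Only the arrow leaving the object `1` has a nontrivial degree, and the turn uses it exactly
once, as its first arrow. -/
theorem Grading.turn_ofWeight_mulSingle (hn : 2 ≤ n) (g : Γ) :
    (Grading.ofWeight (k := k) (n := n) (Pi.mulSingle 1 g)).turn = g := by
  have h : ∀ i, i < n → (Grading.ofWeight (k := k) (n := n) (Pi.mulSingle 1 g)).pathDeg (i + 1) =
      g := by
    intro i hi
    induction i with
    | zero =>
      rw [pathDeg, arrowDeg_ofWeight hn, pathDeg, pow_zero, Pi.mulSingle_eq_same]
      exact mul_one g
    | succ i ih =>
      have h1 : Taft.t k n ^ (i + 1) ≠ 1 := by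
        intro h1
        rw [← pow_zero (Taft.t k n), Taft.t_pow_eq_iff] at h1
        exact absurd (h1.eq_of_lt_of_lt hi (NeZero.pos n)) (Nat.succ_ne_zero i)
      rw [pathDeg, arrowDeg_ofWeight hn, ih (by omega), Pi.mulSingle_eq_of_ne h1]
      exact one_mul g
  obtain ⟨m, rfl⟩ := Nat.exists_eq_succ_of_ne_zero (NeZero.ne n)
  exact h m (Nat.lt_succ_self m)

end Weights

/-! ### Hopf gradings: one common degree for all arrows -/

section HopfWeights

variable {k : Type u} [Field k] {n : ℕ} [NeZero n] {q : k} (hq : IsPrimitiveRoot q n)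

/-- This is the grading by length, a path of length `m` having degree `g ^ m`. The comultiplication
and the antipode preserve total length, and the counit kills positive lengths. -/
theorem Grading.isHopf_ofWeight_const {Γ : Type w} [CommGroup Γ] (g : Γ) :
    (Grading.ofWeight (k := k) (n := n) fun _ => g).IsHopf (taftHopf k n q hq) where
  comm := mul_comm (G := Γ)
  comul := by
    intro (s : Γ) x y f hf x₂ x₁ y₂ y₁ hx hy
    change f ∈ Taft.weightSpace (fun _ => g) s x y at hf
    change Taft.comul hq x y x₂ x₁ y₂ y₁ f ∈ ⨆ (a : Γ) (b : Γ) (_ : a * b = s),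
      LinearMap.range (TensorProduct.map (Taft.weightSpace (fun _ => g) a x₂ y₂).subtype
        (Taft.weightSpace (fun _ => g) b x₁ y₁).subtype)
    induction hf using Submodule.span_induction with
    | mem f hf =>
      obtain ⟨m, rfl, rfl⟩ := hf
      rw [Taft.comul_P hq m hx hy]
      -- The two scalars removed are the Gaussian binomial coefficient and the power of `chi q x₁`.
      refine Submodule.sum_mem _ fun p hp => Submodule.smul_mem _ _ (Submodule.smul_mem _ _ ?_)
      have hp := Finset.HasAntidiagonal.mem_antidiagonal.1 hp
      have h : Taft.weight (fun _ => g) x₂ p.1 * Taft.weight (fun _ => g) x₁ p.2 =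
          Taft.weight (fun _ => g) x m := by
        rw [Taft.weight_const, Taft.weight_const, Taft.weight_const, ← pow_add, hp]
      refine Submodule.mem_iSup_of_mem _ (Submodule.mem_iSup_of_mem _
        (Submodule.mem_iSup_of_mem h ?_))
      exact ⟨⟨_, Taft.P_mem_weightSpace _ _ _ _⟩ ⊗ₜ ⟨_, Taft.P_mem_weightSpace _ _ _ _⟩, rfl⟩
    | zero => rw [map_zero]; exact zero_mem _
    | add f f' _ _ h h' => rw [map_add]; exact add_mem h h'
    | smul c f _ h => rw [map_smul]; exact Submodule.smul_mem _ c h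
  counit := by
    intro (s : Γ) x y f hf hs
    change f ∈ Taft.weightSpace (fun _ => g) s x y at hf
    change Taft.counit x y f = 0
    induction hf using Submodule.span_induction with
    | mem f hf =>
      obtain ⟨m, rfl, rfl⟩ := hf
      rw [Taft.counit_P, if_neg]
      rintro ⟨-, -, rfl⟩
      exact hs rfl
    | zero => rw [map_zero]
    | add f f' _ _ h h' => rw [map_add, h, h', add_zero]
    | smul c f _ h => rw [map_smul, h, smul_zero]
  antipode := by
    intro (s : Γ) x y f hf
    change f ∈ Taft.weightSpace (fun _ => g) s x y at hf
    change Taft.antipode q x y f ∈ Taft.weightSpace (fun _ => g) s y⁻¹ x⁻¹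
    induction hf using Submodule.span_induction with
    | mem f hf =>
      obtain ⟨m, rfl, rfl⟩ := hf
      rw [Taft.antipode_P]
      refine Submodule.smul_mem _ _ ?_
      have h := Taft.P_mem_weightSpace (fun _ => g) m y⁻¹ x⁻¹
      -- For constant weights the degree depends only on the length, so the base point `y⁻¹` can be
      -- exchanged for `x`.
      rwa [Taft.weight_const, ← Taft.weight_const g x] at h
    | zero => rw [map_zero]; exact zero_mem _
    | add f f' _ _ h h' => rw [map_add]; exact add_mem h h'
    | smul c f _ h => rw [map_smul]; exact Submodule.smul_mem _ c h

variable {hq} {X : Grading.{u, u, w, 0} k (Taft k n)}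

theorem Grading.comp_eq_bot {x y : Taft k n} {s : X.Γ} (h : s ≠ X.homDeg x y) :
    X.comp s x y = ⊥ := by
  rw [Submodule.eq_bot_iff]
  intro f hf
  by_contra h0
  exact h (X.eq_homDeg h0 hf)

/-- With `x₂ = x x₁⁻¹`, one component of `Δ(a_x)` is `id_{x₂} ⊗ a_{x₁}`. It is nonzero of degree `1
* deg a_{x₁}`, while homogeneity of `Δ` requires the degree of `a_x`. -/
theorem Grading.IsHopf.arrowDeg_eq (hn : 2 ≤ n) (h : X.IsHopf (taftHopf k n q hq))
    (x x₁ : Taft k n) : X.arrowDeg x = X.arrowDeg x₁ := by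
  by_contra hne
  have h1 := h.comul _ _ (X.arrow_mem x) (x * x₁⁻¹) x₁ (x * x₁⁻¹) (Taft.t k n * x₁)
    (inv_mul_cancel_right x x₁) (by rw [mul_left_comm, inv_mul_cancel_right])
  rw [(taft_comul_arrow k n hn hq x (x * x₁⁻¹) x₁ (inv_mul_cancel_right x x₁)).1] at h1
  -- Both tensor factors have lines of morphisms of known degrees, `1` and `arrowDeg x₁`. If these
  -- do not multiply to `arrowDeg x`, one factor of each summand is zero.
  have h2 : ⨆ (a : X.Γ) (b : X.Γ) (_ : a * b = X.arrowDeg x),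
      LinearMap.range (TensorProduct.map (X.comp a (x * x₁⁻¹) (x * x₁⁻¹)).subtype
        (X.comp b x₁ (Taft.t k n * x₁)).subtype) = ⊥ := by
    simp only [iSup_eq_bot]
    intro a b hab
    rw [LinearMap.range_eq_bot]
    refine TensorProduct.ext' fun f g => ?_
    rw [TensorProduct.map_tmul, LinearMap.zero_apply, Submodule.subtype_apply,
      Submodule.subtype_apply]
    by_cases ha : a = 1
    · have hb : (g : x₁ ⟶ Taft.t k n * x₁) ∈ (⊥ : Submodule k _) := by
        rw [← X.comp_eq_bot (s := b) (x := x₁) (y := Taft.t k n * x₁)]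
        · exact g.2
        · intro hb
          rw [ha, one_mul] at hab
          exact hne (hab.symm.trans hb)
      rw [(Submodule.mem_bot k).1 hb, TensorProduct.tmul_zero]
    · have hb : (f : x * x₁⁻¹ ⟶ x * x₁⁻¹) ∈ (⊥ : Submodule k _) := by
        rw [← X.comp_eq_bot (s := a) (x := x * x₁⁻¹) (y := x * x₁⁻¹)]
        · exact f.2
        · rwa [X.homDeg_self]
      rw [(Submodule.mem_bot k).1 hb, TensorProduct.zero_tmul]
  rw [h2, Submodule.mem_bot] at h1
  -- Functionals equal to `1` on the identity and on the arrow show that their tensor is not zero.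
  obtain ⟨φ, hφ⟩ := Taft.exists_dual (x := x * x₁⁻¹) (y := x * x₁⁻¹) (NeZero.pos n)
    (by rw [pow_zero, one_mul])
  obtain ⟨ψ, hψ⟩ := Taft.exists_dual (x := x₁) (y := Taft.t k n * x₁) (m := 1) (by omega)
    (by rw [pow_one])
  rw [Taft.P_zero] at hφ
  rw [Taft.P_one] at hψ
  have h3 := congrArg (LinearMap.mul' k k ∘ₗ TensorProduct.map φ ψ) h1
  rw [map_zero, LinearMap.comp_apply, TensorProduct.map_tmul, hφ, hψ, LinearMap.mul'_apply,
    mul_one] at h3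
  exact one_ne_zero h3

/-- The turn is `g ^ n` for the common degree `g`, so `g` generates as well. Comparing `N = |Γ|`
with the order `N / gcd(N, n)` of `g ^ n` gives `gcd(N, n) = 1`. -/
theorem Grading.IsHopf.card_coprime (hn : 2 ≤ n) (h : X.IsHopf (taftHopf k n q hq))
    [Finite X.Γ] (hX : ∀ s, s ∈ Subgroup.zpowers X.turn) : (Nat.card X.Γ).Coprime n := by
  have hc : X.turn = X.arrowDeg 1 ^ n := X.pathDeg_eq_pow (fun x => h.arrowDeg_eq hn x 1) n
  have h1 := orderOf_eq_card_of_forall_mem_zpowers hX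
  have h2 : orderOf (X.arrowDeg 1) = Nat.card X.Γ := by
    refine orderOf_eq_card_of_forall_mem_zpowers fun s => ?_
    refine Subgroup.zpowers_le.2 ?_ (hX s)
    rw [hc]
    exact Subgroup.npow_mem_zpowers _ _
  rw [hc, orderOf_pow, h2] at h1
  exact (Nat.div_eq_self.1 h1).resolve_left Nat.card_pos.ne'

end HopfWeights

/-! ### Connected gradings and the fundamental groups -/

section Pi1

variable {k : Type u} [Field k] {n : ℕ} [NeZero n]

theorem ConnectedGrading.mem_zpowers_turn (hn : 2 ≤ n)
    (X : ConnectedGrading.{u, u, w, 0} k (Taft k n)) (s : X.Γ) :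
    s ∈ Subgroup.zpowers X.turn :=
  (X.toGrading.isConnected_iff hn).1 X.isConnected s

theorem ConnectedGrading.isMorphism_iff (hn : 2 ≤ n)
    (X Y : ConnectedGrading.{u, u, w, 0} k (Taft k n)) (μ : X.Γ →* Y.Γ) :
    ConnectedGrading.IsMorphism 1 X Y μ ↔ μ X.turn = Y.turn :=
  ⟨fun ⟨_, hJ⟩ => hJ.map_turn hn, fun h => ⟨LinAut.refl k _, LinAut.realizes_of_map_turn h⟩⟩

/-- The universal connected grading of a Taft category, by an infinite cyclic group. -/
def ConnectedGrading.universal (k : Type u) [Field k] (n : ℕ) [NeZero n] (hn : 2 ≤ n) :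
    ConnectedGrading.{u, u, w, 0} k (Taft k n) where
  toGrading := Grading.ofWeight
    (Pi.mulSingle 1 (ULift.up.{w} (Multiplicative.ofAdd (1 : ℤ))))
  isConnected := by
    rw [Grading.isConnected_iff hn]
    intro (s : ULift.{w} (Multiplicative ℤ))
    refine ⟨Multiplicative.toAdd s.down, ?_⟩
    dsimp only
    rw [Grading.turn_ofWeight_mulSingle hn]
    refine ULift.ext _ _ (Multiplicative.toAdd.injective ?_)
    change Multiplicative.toAdd s.down • (1 : ℤ) = Multiplicative.toAdd s.down
    rw [smul_eq_mul, mul_one]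

theorem ConnectedGrading.turn_universal (hn : 2 ≤ n) :
    (ConnectedGrading.universal.{u, w} k n hn).turn = ULift.up (Multiplicative.ofAdd (1 : ℤ)) :=
  Grading.turn_ofWeight_mulSingle hn _

/-- The family of the `z`-th powers of the turns. -/
def Pi1.ofInt (k : Type u) [Field k] (n : ℕ) [NeZero n] (hn : 2 ≤ n) (z : ℤ) :
    Pi1.{u, u, w, 0} k (1 : Taft k n) :=
  ⟨fun X => X.turn ^ z, fun X Y μ h => by
    rw [map_zpow, (X.isMorphism_iff hn Y μ).1 h]⟩

/-- The exponent of a family, read off in the universal connected grading. -/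
def Pi1.toInt (hn : 2 ≤ n) (γ : Pi1.{u, u, w, 0} k (1 : Taft k n)) : Multiplicative ℤ :=
  (show ULift.{w} (Multiplicative ℤ) from γ.1 (ConnectedGrading.universal k n hn)).down

/-- Naturality along the morphism from the universal grading that sends the generator of `ℤ` to the
turn of `X`. -/
theorem Pi1.eq_turn_zpow (hn : 2 ≤ n) (γ : Pi1.{u, u, w, 0} k (1 : Taft k n))
    (X : ConnectedGrading.{u, u, w, 0} k (Taft k n)) :
    γ.1 X = X.turn ^ Multiplicative.toAdd (Pi1.toInt hn γ) := by
  let μ : (ConnectedGrading.universal.{u, w} k n hn).Γ →* X.Γ :=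
    (zpowersHom X.Γ X.turn).comp (MulEquiv.ulift.toMonoidHom : ULift.{w} (Multiplicative ℤ) →* _)
  have hμ : ConnectedGrading.IsMorphism 1 (ConnectedGrading.universal.{u, w} k n hn) X μ := by
    rw [ConnectedGrading.isMorphism_iff hn, ConnectedGrading.turn_universal]
    exact zpow_one _
  exact (γ.2 _ _ μ hμ).symm

/-- The isomorphism `Π₁(T_{n,q}, 1) ≃ ℤ`. -/
def Pi1.equivInt (k : Type u) [Field k] (n : ℕ) [NeZero n] (hn : 2 ≤ n) :
    Pi1.{u, u, w, 0} k (1 : Taft k n) ≃* Multiplicative ℤ where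
  toFun γ := Pi1.toInt hn γ
  invFun z := Pi1.ofInt k n hn (Multiplicative.toAdd z)
  left_inv γ := Subtype.ext (funext fun X => (Pi1.eq_turn_zpow hn γ X).symm)
  right_inv z := by
    have h : (ConnectedGrading.universal.{u, w} k n hn).turn ^ Multiplicative.toAdd z =
        ULift.up z := by
      rw [ConnectedGrading.turn_universal]
      refine ULift.ext _ _ (Multiplicative.toAdd.injective ?_)
      change Multiplicative.toAdd z • (1 : ℤ) = Multiplicative.toAdd z
      rw [smul_eq_mul, mul_one]
    exact congrArg ULift.down h
  map_mul' _ _ := rfl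

end Pi1

/-! ### Connected Hopf gradings with finite group, and the limit of the cyclic groups -/

section Pi1Hopf

variable {k : Type u} [Field k] {n : ℕ} [NeZero n] {q : k} {hq : IsPrimitiveRoot q n}

namespace ConnectedHopfGrading

theorem isMorphism_iff (hn : 2 ≤ n)
    (X Y : ConnectedHopfGrading.{u, u, w, 0} (taftHopf k n q hq)) (μ : X.Γ →* Y.Γ) :
    X.IsMorphism Y μ ↔ μ X.turn = Y.turn :=
  ⟨fun ⟨_, _, hJ⟩ => hJ.map_turn hn, fun h =>
    ⟨LinAut.refl k _, LinAut.refl_isHopf _, LinAut.realizes_of_map_turn h⟩⟩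

theorem card_coprime (hn : 2 ≤ n) (X : ConnectedHopfGrading.{u, u, w, 0} (taftHopf k n q hq)) :
    (Nat.card X.Γ).Coprime n :=
  have := X.finite
  X.isHopf.card_coprime hn (X.toConnectedGrading.mem_zpowers_turn hn)

/-- The turn of `Y` generates, so a morphism of gradings is surjective. -/
theorem card_dvd (hn : 2 ≤ n) {X Y : ConnectedHopfGrading.{u, u, w, 0} (taftHopf k n q hq)}
    {μ : X.Γ →* Y.Γ} (h : μ X.turn = Y.turn) : Nat.card Y.Γ ∣ Nat.card X.Γ := by
  refine Subgroup.card_dvd_of_surjective μ fun s => ?_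
  obtain ⟨z, rfl⟩ := Y.toConnectedGrading.mem_zpowers_turn hn s
  exact ⟨X.turn ^ z, by rw [map_zpow, h]⟩

omit [NeZero n] in
-- The index `0` does not occur in the limit, since `gcd(0, n) = n ≠ 1`; so all the groups `ZMod m`
-- involved are finite.
theorem neZero_of_coprime (hn : 2 ≤ n) (m : {m : ℕ // m.Coprime n}) : NeZero m.1 :=
  ⟨fun h => by
    have h1 := m.2
    rw [h, Nat.coprime_zero_left] at h1
    omega⟩

/-- The common degree `n⁻¹` is chosen so that the `n` arrows of the turn add up to `1`; coprimality
makes `n` invertible. -/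
theorem turn_cyclic (hn : 2 ≤ n) (m : {m : ℕ // m.Coprime n}) :
    (Grading.ofWeight (k := k) (n := n)
      fun _ => ULift.up.{w} (Multiplicative.ofAdd ((n : ZMod m.1)⁻¹))).turn =
        ULift.up (Multiplicative.ofAdd (1 : ZMod m.1)) := by
  rw [Grading.turn_ofWeight_const hn]
  refine ULift.ext _ _ (Multiplicative.toAdd.injective ?_)
  change n • ((n : ZMod m.1)⁻¹) = 1
  rw [nsmul_eq_mul, ZMod.coe_mul_inv_eq_one n m.2.symm]

theorem up_ofAdd_one_pow {m : ℕ} (a : ℕ) :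
    ULift.up.{w} (Multiplicative.ofAdd (1 : ZMod m)) ^ a =
      ULift.up (Multiplicative.ofAdd (a : ZMod m)) := by
  refine ULift.ext _ _ (Multiplicative.toAdd.injective ?_)
  change a • (1 : ZMod m) = a
  rw [nsmul_one]

/-- The connected Hopf grading of `T_{n,q}` by a cyclic group of order `m`, for `m` coprime to `n`,
with the turn as generator. -/
def cyclic (hq : IsPrimitiveRoot q n) (hn : 2 ≤ n) (m : {m : ℕ // m.Coprime n}) :
    ConnectedHopfGrading.{u, u, w, 0} (taftHopf k n q hq) where
  toGrading := Grading.ofWeight fun _ => ULift.up.{w} (Multiplicative.ofAdd ((n : ZMod m.1)⁻¹))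
  isConnected := by
    have := neZero_of_coprime hn m
    rw [Grading.isConnected_iff hn]
    intro (s : ULift.{w} (Multiplicative (ZMod m.1)))
    refine ⟨((Multiplicative.toAdd s.down).val : ℕ), ?_⟩
    refine (zpow_natCast _ _).trans ?_
    refine ((congrArg (· ^ _) (turn_cyclic.{u, w} (k := k) hn m)).trans
      (up_ofAdd_one_pow _)).trans ?_
    rw [ZMod.natCast_zmod_val]
    rfl
  isHopf := Grading.isHopf_ofWeight_const hq _
  finite := by
    have := neZero_of_coprime hn m
    exact inferInstanceAs (Finite (ULift.{w} (Multiplicative (ZMod m.1))))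

theorem card_cyclic (hn : 2 ≤ n) (m : {m : ℕ // m.Coprime n}) :
    Nat.card (cyclic.{u, w} hq hn m).Γ = m.1 := by
  change Nat.card (ULift.{w} (Multiplicative (ZMod m.1))) = m.1
  rw [Nat.card_congr Equiv.ulift, Nat.card_congr Multiplicative.toAdd, Nat.card_zmod]

/-- Universal property of `ℤ/mℤ`: the generator may be sent to any element killed by `m`. -/
theorem exists_map_turn_cyclic (hn : 2 ≤ n) (m : {m : ℕ // m.Coprime n})
    {Γ : Type w} [Group Γ] {c : Γ} (hc : c ^ m.1 = 1) :
    ∃ μ : (cyclic.{u, w} hq hn m).Γ →* Γ, μ (cyclic.{u, w} hq hn m).turn = c := by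
  let f : ZMod m.1 →+ Additive Γ := ZMod.lift m.1
    ⟨zmultiplesHom (Additive Γ) (Additive.ofMul c), by
      rw [zmultiplesHom_apply, natCast_zsmul, ← ofMul_pow, hc, ofMul_one]⟩
  refine ⟨(AddMonoidHom.toMultiplicativeLeft f).comp
    (MulEquiv.ulift.toMonoidHom : ULift.{w} (Multiplicative (ZMod m.1)) →* _), ?_⟩
  refine (congrArg _ (turn_cyclic.{u, w} (k := k) hn m)).trans ?_
  change (f 1).toMul = c
  have h := ZMod.lift_coe m.1 (⟨zmultiplesHom (Additive Γ) (Additive.ofMul c), by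
      rw [zmultiplesHom_apply, natCast_zsmul, ← ofMul_pow, hc, ofMul_one]⟩ :
        { g : ℤ →+ Additive Γ // g m.1 = 0 }) 1
  rw [Int.cast_one] at h
  refine (congrArg Additive.toMul h).trans ?_
  rw [zmultiplesHom_apply, one_zsmul, toMul_ofMul]

end ConnectedHopfGrading

namespace Pi1Hopf

open ConnectedHopfGrading

/-- The component at `m` of a family: its exponent in the grading by the cyclic group of
order `m`. -/
def toZMod (hn : 2 ≤ n) (δ : Pi1Hopf.{u, u, w, 0} (taftHopf k n q hq))
    (m : {m : ℕ // m.Coprime n}) : ZMod m.1 :=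
  Multiplicative.toAdd (show ULift.{w} (Multiplicative (ZMod m.1)) from δ.1 (cyclic hq hn m)).down

theorem apply_cyclic (hn : 2 ≤ n) (δ : Pi1Hopf.{u, u, w, 0} (taftHopf k n q hq))
    (m : {m : ℕ // m.Coprime n}) :
    δ.1 (cyclic hq hn m) = (cyclic.{u, w} hq hn m).turn ^ (toZMod hn δ m).val := by
  have := neZero_of_coprime hn m
  refine Eq.trans ?_ (congrArg (· ^ (toZMod hn δ m).val) (turn_cyclic.{u, w} (k := k) hn m)).symm
  refine Eq.trans ?_ (up_ofAdd_one_pow _).symm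
  rw [ZMod.natCast_zmod_val]
  rfl

/-- Naturality along the morphism from the cyclic grading of order `m`. Allowing any `m` that kills
the turn serves two purposes: `m = |Γ_X|` gives the formula for `δ_X`, and a multiple `m` of the
order gives compatibility of the residues. -/
theorem eq_turn_pow_of_pow_eq_one (hn : 2 ≤ n) (δ : Pi1Hopf.{u, u, w, 0} (taftHopf k n q hq))
    (m : {m : ℕ // m.Coprime n}) (X : ConnectedHopfGrading.{u, u, w, 0} (taftHopf k n q hq))
    (hX : X.turn ^ m.1 = 1) : δ.1 X = X.turn ^ (toZMod hn δ m).val := by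
  obtain ⟨μ, hμ⟩ := exists_map_turn_cyclic.{u, w} (hq := hq) hn m hX
  rw [← δ.2 _ _ μ ((isMorphism_iff hn _ _ _).2 hμ), apply_cyclic, map_pow, hμ]

theorem eq_turn_pow (hn : 2 ≤ n) (δ : Pi1Hopf.{u, u, w, 0} (taftHopf k n q hq))
    (X : ConnectedHopfGrading.{u, u, w, 0} (taftHopf k n q hq)) :
    δ.1 X = X.turn ^ (toZMod hn δ ⟨Nat.card X.Γ, X.card_coprime hn⟩).val :=
  eq_turn_pow_of_pow_eq_one hn δ _ X pow_card_eq_one'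

theorem toZMod_mem (hn : 2 ≤ n) (δ : Pi1Hopf.{u, u, w, 0} (taftHopf k n q hq)) :
    toZMod hn δ ∈ coprimeLim n := by
  intro m m' h
  have := neZero_of_coprime hn m
  have h1 := turn_cyclic.{u, w} (k := k) hn m'
  -- Since `m' ∣ m`, the grading of order `m'` receives a morphism from the one of order `m`; its
  -- value is then read off with exponent modulo `m` and modulo `m'`.
  have h2 : (cyclic.{u, w} hq hn m').turn ^ m.1 = 1 := by
    refine (congrArg (· ^ m.1) h1).trans ((up_ofAdd_one_pow _).trans ?_)
    rw [(ZMod.natCast_eq_zero_iff _ _).2 h]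
    rfl
  have h3 := (eq_turn_pow_of_pow_eq_one hn δ m (cyclic hq hn m') h2).trans
    ((congrArg (· ^ (toZMod hn δ m).val) h1).trans (up_ofAdd_one_pow _))
  rw [ZMod.castHom_apply, ← ZMod.natCast_val]
  exact (congrArg (fun s : ULift.{w} (Multiplicative (ZMod m'.1)) =>
    Multiplicative.toAdd s.down) h3).symm

/-- The family of powers of the turns with exponents given by a compatible family of residues. -/
def ofLim (hq : IsPrimitiveRoot q n) (hn : 2 ≤ n) (r : coprimeLim n) :
    Pi1Hopf.{u, u, w, 0} (taftHopf k n q hq) :=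
  ⟨fun X => X.turn ^ (r.1 ⟨Nat.card X.Γ, X.card_coprime hn⟩).val, fun X Y μ h => by
    have hμ := (isMorphism_iff hn X Y μ).1 h
    have hd := card_dvd hn hμ
    have := neZero_of_coprime hn ⟨_, X.card_coprime hn⟩
    have := neZero_of_coprime hn ⟨_, Y.card_coprime hn⟩
    rw [map_pow, hμ, pow_eq_pow_iff_modEq]
    -- The exponents come from moduli `|Γ_X|` and `|Γ_Y|`, the second dividing the first. It is
    -- enough that they agree modulo `|Γ_Y|`, which is the compatibility of `r`.
    refine Nat.ModEq.of_dvd (orderOf_dvd_natCard Y.turn) ?_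
    rw [← ZMod.natCast_eq_natCast_iff, ZMod.natCast_zmod_val,
      ← r.2 ⟨_, X.card_coprime hn⟩ ⟨_, Y.card_coprime hn⟩ hd, ZMod.castHom_apply,
      ZMod.natCast_val]⟩

omit [NeZero n] in
-- Transport of a residue along an equality of moduli, needed because the order of the group of
-- `cyclic hq hn m` equals `m` only propositionally.
theorem natCast_val_eq (hn : 2 ≤ n) (r : ∀ m : {m : ℕ // m.Coprime n}, ZMod m.1)
    (m m' : {m : ℕ // m.Coprime n}) (h : m' = m) : ((r m').val : ZMod m.1) = r m := by
  subst h
  have := neZero_of_coprime hn m'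
  exact ZMod.natCast_zmod_val _

/-- The isomorphism between `Π₁ᴴ(T_{n,q})` and the limit of the groups `ℤ/mℤ`, for `m` coprime
to `n`. -/
def equivLim (hq : IsPrimitiveRoot q n) (hn : 2 ≤ n) :
    Pi1Hopf.{u, u, w, 0} (taftHopf k n q hq) ≃* Multiplicative (coprimeLim n) where
  toFun δ := Multiplicative.ofAdd ⟨toZMod hn δ, toZMod_mem hn δ⟩
  invFun r := ofLim hq hn (Multiplicative.toAdd r)
  left_inv δ := Subtype.ext (funext fun X => (eq_turn_pow hn δ X).symm)
  right_inv r := by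
    refine Multiplicative.toAdd.injective (Subtype.ext (funext fun m => ?_))
    have h : (ofLim.{u, w} hq hn (Multiplicative.toAdd r)).1 (cyclic hq hn m) = ULift.up
        (Multiplicative.ofAdd (((Multiplicative.toAdd r).1 ⟨Nat.card (cyclic.{u, w} hq hn m).Γ,
          card_coprime hn _⟩).val : ZMod m.1)) :=
      (congrArg (· ^ _) (turn_cyclic.{u, w} (k := k) hn m)).trans (up_ofAdd_one_pow _)
    refine (congrArg (fun s : ULift.{w} (Multiplicative (ZMod m.1)) =>
      Multiplicative.toAdd s.down) h).trans ?_
    exact natCast_val_eq hn _ _ _ (Subtype.ext (card_cyclic hn m))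
  map_mul' _ _ := rfl

end Pi1Hopf

/-! ### The comparison square -/

theorem toCoprimeLim_injective (n : ℕ) [NeZero n] : Function.Injective (toCoprimeLim n) := by
  rw [injective_iff_map_eq_zero]
  intro z hz
  -- A modulus coprime to `n` and larger than `|z|`, so that it can divide `z` only if `z = 0`.
  have hc : (z.natAbs * n + 1).Coprime n := by
    rw [Nat.coprime_mul_right_add_left]
    exact Nat.coprime_one_left n
  have h : (z : ZMod (z.natAbs * n + 1)) = 0 :=
    congrFun (congrArg Subtype.val hz) ⟨_, hc⟩
  rw [ZMod.intCast_zmod_eq_zero_iff_dvd, Int.natCast_dvd] at h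
  refine Int.natAbs_eq_zero.1 (Nat.eq_zero_of_dvd_of_lt h (Nat.lt_succ_of_le ?_))
  exact Nat.le_mul_of_pos_right _ (NeZero.pos n)

/-- The component at `m` of either side is the value of `γ` in the cyclic grading of order `m`,
where the turn is `1` and its `z`-th power is the residue of `z`. -/
theorem equivLim_tau (hn : 2 ≤ n) (γ : Pi1.{u, u, w, 0} k (1 : Taft k n)) :
    Pi1Hopf.equivLim hq hn (tau (taftHopf k n q hq) γ) =
      Multiplicative.ofAdd (toCoprimeLim n (Multiplicative.toAdd (Pi1.equivInt k n hn γ))) := by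
  refine Multiplicative.toAdd.injective (Subtype.ext (funext fun m => ?_))
  have h := Pi1.eq_turn_zpow hn γ (ConnectedHopfGrading.cyclic hq hn m).toConnectedGrading
  have h1 : ∀ z : ℤ, ULift.up.{w} (Multiplicative.ofAdd (1 : ZMod m.1)) ^ z =
      ULift.up (Multiplicative.ofAdd (z : ZMod m.1)) := by
    intro z
    refine ULift.ext _ _ (Multiplicative.toAdd.injective ?_)
    change z • (1 : ZMod m.1) = z
    rw [zsmul_one]
  have h2 := h.trans ((congrArg (· ^ _)
    (ConnectedHopfGrading.turn_cyclic.{u, w} (k := k) hn m)).trans (h1 _))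
  exact congrArg (fun s : ULift.{w} (Multiplicative (ZMod m.1)) =>
      Multiplicative.toAdd s.down) h2

end Pi1Hopf

end HopfCat

end

theorem mainTheorem8 {k : Type u} [Field k] (n : ℕ) [NeZero n] (hn : 2 ≤ n) (q : k)
    (hq : IsPrimitiveRoot q n) :
    ∃ (L : HopfCat.Pi1.{u, u, w, 0} k (1 : HopfCat.Taft k n) ≃* Multiplicative ℤ)
      (R : HopfCat.Pi1Hopf.{u, u, w, 0} (HopfCat.taftHopf k n q hq) ≃*
        Multiplicative (HopfCat.coprimeLim n)),
      -- the left isomorphism: `γ_X` is the `L(γ)`-th power of the degree of the turn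
      (∀ (γ : HopfCat.Pi1.{u, u, w, 0} k (1 : HopfCat.Taft k n))
        (X : HopfCat.ConnectedGrading.{u, u, w, 0} k (HopfCat.Taft k n)),
        ∃ c : X.Γ, X.IsTurnDegree c ∧ γ.1 X = c ^ Multiplicative.toAdd (L γ)) ∧
      -- the right isomorphism: same description, with `m` the order of the grading group
      (∀ (δ : HopfCat.Pi1Hopf.{u, u, w, 0} (HopfCat.taftHopf k n q hq))
        (X : HopfCat.ConnectedHopfGrading.{u, u, w, 0} (HopfCat.taftHopf k n q hq)),
        ∃ (c : X.Γ) (hm : (Nat.card X.Γ).Coprime n), X.IsTurnDegree c ∧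
          δ.1 X = c ^ ((Multiplicative.toAdd (R δ)).1 ⟨Nat.card X.Γ, hm⟩).val) ∧
      -- the diagram commutes
      (∀ γ : HopfCat.Pi1.{u, u, w, 0} k (1 : HopfCat.Taft k n),
        R (HopfCat.tau (HopfCat.taftHopf k n q hq) γ) =
          Multiplicative.ofAdd (HopfCat.toCoprimeLim n (Multiplicative.toAdd (L γ)))) ∧
      Function.Injective (HopfCat.toCoprimeLim n) ∧
      Function.Injective
        (HopfCat.tau.{u, u, w, 0} (HopfCat.taftHopf k n q hq)) := by
  refine ⟨HopfCat.Pi1.equivInt k n hn, HopfCat.Pi1Hopf.equivLim hq hn,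
    fun γ X => ⟨X.turn, X.isTurnDegree_turn, HopfCat.Pi1.eq_turn_zpow hn γ X⟩,
    fun δ X => ⟨X.turn, X.card_coprime hn, X.isTurnDegree_turn,
      HopfCat.Pi1Hopf.eq_turn_pow hn δ X⟩,
    HopfCat.equivLim_tau hn, HopfCat.toCoprimeLim_injective n, fun γ γ' h => ?_⟩
  -- Injectivity of `τ` is read off the square: `R ∘ τ` is the composite of the injective maps `L`
  -- and `toCoprimeLim n`.
  have h1 := congrArg (HopfCat.Pi1Hopf.equivLim hq hn) h
  rw [HopfCat.equivLim_tau, HopfCat.equivLim_tau] at h1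
  exact (HopfCat.Pi1.equivInt k n hn).injective (Multiplicative.toAdd.injective
    (HopfCat.toCoprimeLim_injective n (Multiplicative.ofAdd.injective h1)))
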